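/- **Setting.** Let $n\ge 1$, $0\le\gamma<1$, $\alpha=\frac{4}{3+\gamma}$ and $\Delta_\infty u=\sum_{i,j}D_{ij}u\,D_iu\,D_ju$. Let $\delta>0$ and let $\mathcal B:\mathbb R\to\mathbb R$ be Lipschitz with $0\le\mathcal B\le1$ on $[0,\infty)$, $\mathcal B(s)=0$ for $s\le\delta/2$ and $\mathcal B(s)=1$ for $s\ge\delta$; put $\mathcal B_\varepsilon(s)=\mathcal B(s/\varepsilon^\alpha)$. For a bounded domain $\Omega\subset\mathbb R^n$ consider $(P_0)$: $\Delta_\infty u=u^{-\gamma}$ in $\Omega\cap\{u>0\}$, $u=\varphi$ on $\partial\Omega$; $(P_\varepsilon)$: $\Delta_\infty u=\mathcal B_\varepsilon(u)\,u^{-\gamma}$ in $\Omega$, $u=\varphi_\varepsilon$ on $\partial\Omega$, in the viscosity sense, where $\mathcal B_\varepsilon(s)s^{-\gamma}$ is read as $0$ for $s\le 0$. The minimal solution of $(P_\varepsilon)$ is the nonnegative viscosity solution $u_\varepsilon\in C(\overline\Omega)$ that lies below every viscosity supersolution in $C(\overline\Omega)$ with the same boundary values. A function $u\in C(\overline\Omega)$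 with $u=\varphi$ on $\partial\Omega$ is a *limiting solution* of $(P_0)$ if there are nonnegative $\varphi_\varepsilon\in W^{2,\infty}(\partial\Omega)$ ($\varepsilon>0$) with $\varphi_\varepsilon\to\varphi$ uniformly on $\partial\Omega$ as $\varepsilon\to0^+$, such that $(P_\varepsilon)$ has a minimal solution $u_\varepsilon$ for every $\varepsilon>0$ and $u_\varepsilon\to u$ locally uniformly in $\Omega$. **Proposition 6.1.** Let $C,R>0$ satisfy $$R=\Big(\frac{C}{C_\alpha}\Big)^{1/\alpha},\qquad C_\alpha=\Big(\frac1{\alpha^3(\alpha-1)}\Big)^{\frac1{3+\gamma}},$$ and let $\omega(x)=C_\alpha|x|^\alpha$. Then: 1. $\omega$ is a limiting solution of $(P_0)$ in $\Omega=B_R$ with $\varphi=C$ on $\partial B_R$. The data can be chosen as constants $C_\varepsilon\to C$ such that the minimal solutions $u_\varepsilon$ are radial and converge to $\omega$ uniformly on $\overline{B_R}$. Moreover $\omega$ is a nonnegative viscosity solution of $(P_0)$ in $B_R$ with $\varphi=C$. 2. For $\varepsilon>0$ let $\omega_\varepsilon(x)=C_\alpha(|x|+\varepsilon)^\alpha$.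 If $\delta\le C_\alpha$, then $\Delta_\infty\omega_\varepsilon=\mathcal B_\varepsilon(\omega_\varepsilon)\,\omega_\varepsilon^{-\gamma}$ in $B_R\setminus\{0\}$. Without this restriction on $\delta$: $\omega_\varepsilon=C_\alpha(R+\varepsilon)^\alpha$ on $\partial B_R$, which tends to $C$ as $\varepsilon\to0^+$; $\omega_\varepsilon\to\omega$ uniformly on $\overline{B_R}$; $\min_{B_R}\omega_\varepsilon=C_\alpha\varepsilon^\alpha$; and $\partial\{\omega_\varepsilon>C_\alpha\varepsilon^\alpha\}\cap B_R=\{0\}$. 3. The free boundary of $\omega$ is a point: $\partial\{\omega>0\}\cap B_R=\{0\}$. 4. The exponent $\alpha$ is optimal: $\sup_{B_r}\omega=C_\alpha r^\alpha$ for $0<r\le R$, and $\omega$ is of class $C^{1,\alpha-1}$ at the free boundary point $0$ but not of class $C^{1,\beta}$ at $0$ for any $\beta>\alpha-1$. Here $u$ is of class $C^{1,\beta}$ at $x$ if there are a linear map $p$ and constants $K$, $r>0$ with $|u(y)-u(x)-p(y-x)|\le K|y-x|^{1+\beta}$ for $y\in B_r(x)$. -/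

import Mathlib

open Set Filter Topology
open scoped ContDiff

namespace SingInf

noncomputable section

/-- `E n` is `ℝⁿ` with the Euclidean norm. -/
abbrev E (n : ℕ) : Type := EuclideanSpace ℝ (Fin n)

/-- The infinity Laplacian `Δ_∞ φ (x) = ∑ᵢⱼ Dᵢⱼφ(x) Dᵢφ(x) Dⱼφ(x) = ⟨D²φ(x) Dφ(x), Dφ(x)⟩`,
meaningful where `φ` is twice continuously differentiable. -/
def infLaplacian {n : ℕ} (φ : E n → ℝ) (x : E n) : ℝ :=
  fderiv ℝ (fderiv ℝ φ) x (gradient φ x) (gradient φ x)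

/-- Viscosity subsolution of `Δ_∞ u = G(u)` in the open set `Ω`. -/
def IsViscositySub {n : ℕ} (G : ℝ → ℝ) (Ω : Set (E n)) (u : E n → ℝ) : Prop :=
  ContinuousOn u Ω ∧ ∀ x ∈ Ω, ∀ φ : E n → ℝ, ContDiffAt ℝ 2 φ x →
    IsLocalMax (fun y => u y - φ y) x → G (u x) ≤ infLaplacian φ x

/-- Viscosity supersolution of `Δ_∞ u = G(u)` in the open set `Ω`. -/
def IsViscositySuper {n : ℕ} (G : ℝ → ℝ) (Ω : Set (E n)) (u : E n → ℝ) : Prop :=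
  ContinuousOn u Ω ∧ ∀ x ∈ Ω, ∀ φ : E n → ℝ, ContDiffAt ℝ 2 φ x →
    IsLocalMin (fun y => u y - φ y) x → infLaplacian φ x ≤ G (u x)

/-- Viscosity solution of `Δ_∞ u = G(u)` in the open set `Ω`. -/
def IsViscositySol {n : ℕ} (G : ℝ → ℝ) (Ω : Set (E n)) (u : E n → ℝ) : Prop :=
  IsViscositySub G Ω u ∧ IsViscositySuper G Ω u

/-- The exponent `α = 4 / (3 + γ)`. -/
def alpha (γ : ℝ) : ℝ := 4 / (3 + γ)

/-- The constant `C_α = (1 / (α³ (α - 1))) ^ (1 / (3 + γ))`. -/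
def radialConst (γ : ℝ) : ℝ :=
  (1 / (alpha γ ^ 3 * (alpha γ - 1))) ^ (1 / (3 + γ))

/-- The admissible cut-off functions `𝓑` with parameter `δ > 0`. -/
structure IsCutoff (δ : ℝ) (B : ℝ → ℝ) : Prop where
  delta_pos : 0 < δ
  lipschitz : ∃ K : NNReal, LipschitzWith K B
  mem_Icc : ∀ s, 0 ≤ s → B s ∈ Icc (0 : ℝ) 1
  eq_zero : ∀ s, s ≤ δ / 2 → B s = 0
  eq_one : ∀ s, δ ≤ s → B s = 1

/-- The right-hand side `s ↦ 𝓑_ε(s) s^(-γ)`, where `𝓑_ε(s) = 𝓑(s / ε^α)`.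
For an admissible cut-off and `ε > 0` it vanishes for all `s ≤ δ ε^α / 2`. -/
def penalizedRHS (γ : ℝ) (B : ℝ → ℝ) (ε : ℝ) (s : ℝ) : ℝ :=
  B (s / ε ^ alpha γ) * s ^ (-γ)

/-- `u ∈ C(closure Ω)` is a viscosity supersolution of the penalized Dirichlet problem
`Δ_∞ u = 𝓑_ε(u) u^(-γ)` in `Ω`, with `u = φ` on `∂Ω`. -/
structure IsPenalizedSuper {n : ℕ} (γ : ℝ) (B : ℝ → ℝ) (ε : ℝ) (Ω : Set (E n))
    (φ u : E n → ℝ) : Prop where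
  continuousOn : ContinuousOn u (closure Ω)
  boundary : EqOn u φ (frontier Ω)
  super : IsViscositySuper (penalizedRHS γ B ε) Ω u

/-- `u` is the nonnegative minimal (Perron) solution of the penalized Dirichlet problem: a
nonnegative continuous viscosity solution that lies below every continuous viscosity supersolution
with the same boundary values. -/
structure IsMinimalSol {n : ℕ} (γ : ℝ) (B : ℝ → ℝ) (ε : ℝ) (Ω : Set (E n))
    (φ u : E n → ℝ) : Prop where
  continuousOn : ContinuousOn u (closure Ω)
  boundary : EqOn u φ (frontier Ω)
  sol : IsViscositySol (penalizedRHS γ B ε) Ω u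
  nonneg : ∀ x ∈ closure Ω, 0 ≤ u x
  least : ∀ w : E n → ℝ, IsPenalizedSuper γ B ε Ω φ w → ∀ x ∈ closure Ω, u x ≤ w x

/-- Nonnegative boundary data of class `W^{2,∞}(∂Ω)`: the restriction to `∂Ω` is nonnegative and
extends to a `C^{1,1}` function on `ℝⁿ`. -/
def IsBoundaryDatum {n : ℕ} (Ω : Set (E n)) (φ : E n → ℝ) : Prop :=
  (∀ x ∈ frontier Ω, 0 ≤ φ x) ∧
    ∃ ψ : E n → ℝ, ContDiff ℝ 1 ψ ∧ (∃ K : NNReal, LipschitzWith K (fderiv ℝ ψ)) ∧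
      EqOn ψ φ (frontier Ω)

/-- `u ∈ C(closure Ω)` is the limit, as `ε → 0⁺`, of the minimal solutions `uε ε` of the penalized
problems with boundary data `φε ε → φ`. -/
structure IsLimitOfMinimal {n : ℕ} (γ : ℝ) (B : ℝ → ℝ) (Ω : Set (E n)) (φ : E n → ℝ)
    (φε uε : ℝ → E n → ℝ) (u : E n → ℝ) : Prop where
  datum : ∀ ε, 0 < ε → IsBoundaryDatum Ω (φε ε)
  datum_tendsto : TendstoUniformlyOn φε φ (𝓝[>] 0) (frontier Ω)
  minimal : ∀ ε, 0 < ε → IsMinimalSol γ B ε Ω (φε ε) (uε ε)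
  tendsto : TendstoLocallyUniformlyOn uε u (𝓝[>] 0) Ω
  continuousOn : ContinuousOn u (closure Ω)
  boundary : EqOn u φ (frontier Ω)

/-- Limiting solutions of the free boundary problem. -/
def IsLimitingSol {n : ℕ} (γ : ℝ) (B : ℝ → ℝ) (Ω : Set (E n)) (φ u : E n → ℝ) : Prop :=
  ∃ φε uε : ℝ → E n → ℝ, IsLimitOfMinimal γ B Ω φ φε uε u

/-- Nonnegative viscosity solutions of the free boundary problem
`Δ_∞ u = u^(-γ)` in `Ω ∩ {u > 0}`, `u = φ` on `∂Ω`. -/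
structure IsFreeBoundarySol {n : ℕ} (γ : ℝ) (Ω : Set (E n)) (φ u : E n → ℝ) : Prop where
  continuousOn : ContinuousOn u (closure Ω)
  nonneg : ∀ x ∈ closure Ω, 0 ≤ u x
  sol : IsViscositySol (fun s => s ^ (-γ)) (Ω ∩ {x | 0 < u x}) u
  boundary : EqOn u φ (frontier Ω)

/-- The free boundary `∂{u > 0} ∩ Ω`; the set `{u > 0}` is taken in `Ω`. -/
def freeBoundary {n : ℕ} (Ω : Set (E n)) (u : E n → ℝ) : Set (E n) :=
  frontier {x | x ∈ Ω ∧ 0 < u x} ∩ Ω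

/-- `u` is of class `C^{1,β}` at the point `x`: near `x` it differs from an affine function by at
most a multiple of `|y - x|^(1+β)`. -/
def IsC1HolderAt {n : ℕ} (β : ℝ) (u : E n → ℝ) (x : E n) : Prop :=
  ∃ p : E n →L[ℝ] ℝ, ∃ K r : ℝ, 0 < r ∧
    ∀ y ∈ Metric.ball x r, |u y - u x - p (y - x)| ≤ K * ‖y - x‖ ^ (1 + β)

/-- The radial profile `ω(x) = C_α |x|^α`. -/
def omega {n : ℕ} (γ : ℝ) (x : E n) : ℝ := radialConst γ * ‖x‖ ^ alpha γ

/-- The shifted radial profiles `ω_ε(x) = C_α (|x| + ε)^α`. -/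
def omegaShift {n : ℕ} (γ ε : ℝ) (x : E n) : ℝ := radialConst γ * (‖x‖ + ε) ^ alpha γ

end

end SingInf

/-! For a radial function `g ‖x‖` the operator reduces to `(g')² g''`, so with `P = (g')³` the
penalized equation becomes the system `g' = P^(1/3)`, `P' = 3 f(g)`. The function `ω` solves this
explicitly for `f(s) = s^(-γ)` by the choice of `α` and `C_α`. The difficulty is to identify minimal
solutions of the penalized problem and to show that they converge to `ω`.

Minimality comes from sweeping. If `f` is replaced by `f + η` and the initial slope is made
positive, a profile is a strict subsolution away from the origin and has a convex kink at the
origin. A supersolution `w` can be touched from below at neither kind of point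
(`IsViscositySuper.le_of_touching_radial`, `IsViscositySuper.not_kink`). Raising the initial value
continuously therefore keeps the profile below `w` as long as its boundary value stays below that of
`w` (`profile_le_super`). As the perturbation tends to zero, compactness gives a profile of zero
initial slope below all supersolutions (`exists_least_profile`). It is itself a viscosity solution
(`IsProfile.isViscositySol`), hence the minimal one.

Since the cube root is not Lipschitz at zero, profiles of zero initial slope need not be unique. The
boundary constant is therefore taken to be `W R`, where the profile `W` starts at `δ ε^α`, the level
from which the cut-off equals one. Minimality bounds the solution above by `W`. The energy
inequality for `(g')⁴` says that `(g / C_α)^(1/α)` grows at most at unit speed. This bounds `W` from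
above, bounds the minimal solution from below starting at the boundary, and, fed back into the
equation, bounds `W R` from below (`IsProfile.le_val_of_radius`). All bounds converge to `ω`, and a
squeeze gives uniform convergence. The remaining claims are direct computations with explicit powers
of the norm. -/

namespace SingInf

/-! ### Second-order tests along lines -/

/-- The necessary second-order condition at a local minimum. -/
theorem second_deriv_nonneg_of_isLocalMin {ψ ψ' : ℝ → ℝ} {a x : ℝ}
    (h1 : ∀ᶠ t in 𝓝 x, HasDerivAt ψ (ψ' t) t) (h2 : HasDerivAt ψ' a x)
    (hmin : IsLocalMin ψ x) : 0 ≤ a := by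
  by_contra! ha
  have hd : deriv ψ =ᶠ[𝓝 x] ψ' := h1.mono fun t ht => ht.deriv
  have hdd : deriv (deriv ψ) x = a := by rw [hd.deriv_eq, h2.deriv]
  have h0 : deriv ψ x = 0 := hmin.deriv_eq_zero
  -- A negative second derivative makes the local minimum a local maximum as well, so `ψ` is locally
  -- constant and its second derivative is zero.
  have hmax : IsLocalMax ψ x :=
    isLocalMax_of_deriv_deriv_neg (by rwa [hdd]) h0 h1.self_of_nhds.continuousAt
  have hc : ψ =ᶠ[𝓝 x] fun _ => ψ x := by
    filter_upwards [hmin, hmax] with t ht1 ht2 using le_antisymm ht2 ht1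
  have hc' : deriv ψ =ᶠ[𝓝 x] fun _ => 0 := by
    filter_upwards [hc.eventuallyEq_nhds] with t ht
    rw [ht.deriv_eq, deriv_const]
  rw [hc'.deriv_eq, deriv_const] at hdd
  exact ha.ne hdd.symm

section Restriction

variable {F : Type*} [NormedAddCommGroup F] [NormedSpace ℝ F]

theorem hasDerivAt_restrict_line {φ : F → ℝ} {x : F} (hφ : ContDiffAt ℝ 2 φ x) (e : F) :
    (∀ᶠ t in 𝓝 (0 : ℝ), HasDerivAt (fun t : ℝ => φ (x + t • e)) (fderiv ℝ φ (x + t • e) e) t) ∧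
    HasDerivAt (fun t : ℝ => fderiv ℝ φ (x + t • e) e) (fderiv ℝ (fderiv ℝ φ) x e e) 0 := by
  have hline : ∀ t : ℝ, HasDerivAt (fun t : ℝ => x + t • e) e t := fun t => by
    simpa using ((hasDerivAt_id t).smul_const e).const_add x
  have htend : Tendsto (fun t : ℝ => x + t • e) (𝓝 0) (𝓝 x) := by
    have := (hline 0).continuousAt.tendsto
    simpa using this
  constructor
  · have h1 : ∀ᶠ y in 𝓝 x, DifferentiableAt ℝ φ y :=
      (hφ.eventually (by simp)).mono fun y hy => hy.differentiableAt (by norm_num)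
    filter_upwards [htend.eventually h1] with t ht
    exact ht.hasFDerivAt.comp_hasDerivAt t (hline t)
  · have h2 : DifferentiableAt ℝ (fderiv ℝ φ) (x + (0 : ℝ) • e) := by
      have : ContDiffAt ℝ 1 (fderiv ℝ φ) x := hφ.fderiv_right (by norm_num)
      simpa using this.differentiableAt (by norm_num)
    have h3 := h2.hasFDerivAt.comp_hasDerivAt 0 (hline 0)
    have h4 := h3.clm_apply (hasDerivAt_const (0 : ℝ) e)
    simpa using h4

theorem le_second_fderiv_of_isLocalMin {φ : F → ℝ} {x e : F} (hφ : ContDiffAt ℝ 2 φ x)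
    {k k' : ℝ → ℝ} {a : ℝ} (h1 : ∀ᶠ t in 𝓝 0, HasDerivAt k (k' t) t) (h2 : HasDerivAt k' a 0)
    (hmin : IsLocalMin (fun t : ℝ => φ (x + t • e) - k t) 0) :
    a ≤ fderiv ℝ (fderiv ℝ φ) x e e := by
  obtain ⟨h3, h4⟩ := hasDerivAt_restrict_line hφ e
  have := second_deriv_nonneg_of_isLocalMin (h3.and h1 |>.mono fun t ht => ht.1.sub ht.2)
    (h4.sub h2) hmin
  linarith

theorem second_fderiv_le_of_isLocalMax {φ : F → ℝ} {x e : F} (hφ : ContDiffAt ℝ 2 φ x)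
    {k k' : ℝ → ℝ} {a : ℝ} (h1 : ∀ᶠ t in 𝓝 0, HasDerivAt k (k' t) t) (h2 : HasDerivAt k' a 0)
    (hmax : IsLocalMax (fun t : ℝ => φ (x + t • e) - k t) 0) :
    fderiv ℝ (fderiv ℝ φ) x e e ≤ a := by
  obtain ⟨h3, h4⟩ := hasDerivAt_restrict_line hφ e
  have := second_deriv_nonneg_of_isLocalMin (h3.and h1 |>.mono fun t ht => ht.2.sub ht.1)
    (h2.sub h4) (by simpa [Pi.sub_def] using hmax.neg)
  linarith

end Restriction

variable {n : ℕ}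

/-- Only the second derivative along the gradient enters, so every viscosity test reduces to a
one-variable comparison on the line through `x` in direction `e`. -/
theorem infLaplacian_of_fderiv_eq {φ : E n → ℝ} {x e : E n} {p : ℝ}
    (h : fderiv ℝ φ x = p • innerSL ℝ e) :
    infLaplacian φ x = p ^ 2 * fderiv ℝ (fderiv ℝ φ) x e e := by
  have hg : gradient φ x = p • e := by
    rw [gradient, h]
    apply (InnerProductSpace.toDual ℝ (E n)).injective
    ext y
    simp
  rw [infLaplacian, hg]
  simp
  ring

theorem infLaplacian_of_fderiv_eq_zero {φ : E n → ℝ} {x : E n} (h : fderiv ℝ φ x = 0) :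
    infLaplacian φ x = 0 := by
  rw [infLaplacian_of_fderiv_eq (e := 0) (p := 0) (by simpa using h)]
  simp

theorem hasFDerivAt_radial {g : ℝ → ℝ} {p : ℝ} {x : E n} (hx : x ≠ 0)
    (hg : HasDerivAt g p ‖x‖) :
    HasFDerivAt (fun y : E n => g ‖y‖) (p • innerSL ℝ (‖x‖⁻¹ • x)) x := by
  have h1 : HasFDerivAt (fun y : E n => ‖y‖) (innerSL ℝ (‖x‖⁻¹ • x)) x := by
    have h2 := (hasStrictFDerivAt_norm_sq x).hasFDerivAt.sqrt (by simpa using hx)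
    have h3 : (fun y : E n => √(‖y‖ ^ 2)) = fun y => ‖y‖ := by
      ext y; exact Real.sqrt_sq (norm_nonneg y)
    rw [h3] at h2
    refine h2.congr_fderiv ?_
    ext y
    have : ‖x‖ ≠ 0 := by simpa using hx
    simp
    field_simp
  exact hg.comp_hasFDerivAt x h1

theorem isLocalMax_line {u φ : E n → ℝ} {x : E n} (h : IsLocalMax (fun y => u y - φ y) x)
    (e : E n) : IsLocalMin (fun t : ℝ => φ (x + t • e) - u (x + t • e)) 0 := by
  have ht : Tendsto (fun t : ℝ => x + t • e) (𝓝 0) (𝓝 x) := by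
    have : Continuous fun t : ℝ => x + t • e := by fun_prop
    simpa using this.tendsto 0
  filter_upwards [ht.eventually h] with t ht
  simp only [zero_smul, add_zero]
  linarith

theorem isLocalMin_line {u φ : E n → ℝ} {x : E n} (h : IsLocalMin (fun y => u y - φ y) x)
    (e : E n) : IsLocalMax (fun t : ℝ => φ (x + t • e) - u (x + t • e)) 0 := by
  have ht : Tendsto (fun t : ℝ => x + t • e) (𝓝 0) (𝓝 x) := by
    have : Continuous fun t : ℝ => x + t • e := by fun_prop
    simpa using this.tendsto 0
  filter_upwards [ht.eventually h] with t ht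
  simp only [zero_smul, add_zero]
  linarith

theorem fderiv_eq_of_isLocalExtr {u φ : E n → ℝ} {x : E n} {u' : E n →L[ℝ] ℝ}
    (hφ : ContDiffAt ℝ 2 φ x) (hu : HasFDerivAt u u' x)
    (h : IsLocalExtr (fun y => u y - φ y) x) : fderiv ℝ φ x = u' := by
  have h1 := hu.sub (hφ.differentiableAt (by norm_num)).hasFDerivAt
  exact (sub_eq_zero.mp (h.hasFDerivAt_eq_zero h1)).symm

theorem infLaplacian_eq_zero_of_isLocalExtr {u φ : E n → ℝ} {x : E n}
    (hφ : ContDiffAt ℝ 2 φ x) (hu : HasFDerivAt u (0 : E n →L[ℝ] ℝ) x)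
    (h : IsLocalExtr (fun y => u y - φ y) x) : infLaplacian φ x = 0 :=
  infLaplacian_of_fderiv_eq_zero (fderiv_eq_of_isLocalExtr hφ hu h)

/-! ### Radial functions tested by smooth functions -/

section Radial

variable {g g' : ℝ → ℝ} {a : ℝ} {x : E n} {φ : E n → ℝ}

/-- Moving by `t` along the outward unit vector changes the norm by exactly `t` until the origin is
reached, so on this line a radial function is its profile. -/
theorem radial_line (hx : x ≠ 0) (h1 : ∀ᶠ r in 𝓝 ‖x‖, HasDerivAt g (g' r) r)
    (h2 : HasDerivAt g' a ‖x‖) :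
    (∀ᶠ t in 𝓝 (0 : ℝ), HasDerivAt (fun t => g (‖x‖ + t)) (g' (‖x‖ + t)) t) ∧
    HasDerivAt (fun t => g' (‖x‖ + t)) a 0 ∧
    (fun t : ℝ => g ‖x + t • (‖x‖⁻¹ • x)‖) =ᶠ[𝓝 0] fun t => g (‖x‖ + t) := by
  have hpos : 0 < ‖x‖ := norm_pos_iff.mpr hx
  have ht : Tendsto (fun t : ℝ => ‖x‖ + t) (𝓝 0) (𝓝 ‖x‖) := by
    have : Continuous fun t : ℝ => ‖x‖ + t := by fun_prop
    simpa using this.tendsto 0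
  refine ⟨?_, ?_, ?_⟩
  · filter_upwards [ht.eventually h1] with t ht
    exact HasDerivAt.comp_const_add _ _ ht
  · exact HasDerivAt.comp_const_add _ _ (by simpa using h2)
  · filter_upwards [ht.eventually (lt_mem_nhds hpos)] with t ht
    congr 1
    have : x + t • (‖x‖⁻¹ • x) = ((‖x‖ + t) * ‖x‖⁻¹) • x := by
      rw [add_mul, mul_inv_cancel₀ hpos.ne', add_smul, one_smul, mul_smul]
    rw [this, norm_smul, norm_mul, norm_inv, norm_norm, Real.norm_of_nonneg ht.le]
    field_simp

/-- Second order test for radial functions: touching from above. -/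
theorem radial_le_infLaplacian (hx : x ≠ 0) (h1 : ∀ᶠ r in 𝓝 ‖x‖, HasDerivAt g (g' r) r)
    (h2 : HasDerivAt g' a ‖x‖) (hφ : ContDiffAt ℝ 2 φ x)
    (h : IsLocalMax (fun y => g ‖y‖ - φ y) x) : g' ‖x‖ ^ 2 * a ≤ infLaplacian φ x := by
  obtain ⟨h3, h4, h5⟩ := radial_line hx h1 h2
  rw [infLaplacian_of_fderiv_eq
    (fderiv_eq_of_isLocalExtr hφ (hasFDerivAt_radial hx h1.self_of_nhds) (Or.inr h))]
  refine mul_le_mul_of_nonneg_left ?_ (sq_nonneg _)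
  refine le_second_fderiv_of_isLocalMin hφ h3 h4 ?_
  refine (isLocalMax_line (u := fun y => g ‖y‖) h (‖x‖⁻¹ • x)).congr ?_
  filter_upwards [h5] with t ht
  rw [ht]

/-- Second order test for radial functions: touching from below. -/
theorem infLaplacian_le_radial (hx : x ≠ 0) (h1 : ∀ᶠ r in 𝓝 ‖x‖, HasDerivAt g (g' r) r)
    (h2 : HasDerivAt g' a ‖x‖) (hφ : ContDiffAt ℝ 2 φ x)
    (h : IsLocalMin (fun y => g ‖y‖ - φ y) x) : infLaplacian φ x ≤ g' ‖x‖ ^ 2 * a := by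
  obtain ⟨h3, h4, h5⟩ := radial_line hx h1 h2
  rw [infLaplacian_of_fderiv_eq
    (fderiv_eq_of_isLocalExtr hφ (hasFDerivAt_radial hx h1.self_of_nhds) (Or.inl h))]
  refine mul_le_mul_of_nonneg_left ?_ (sq_nonneg _)
  refine second_fderiv_le_of_isLocalMax hφ h3 h4 ?_
  refine (isLocalMin_line (u := fun y => g ‖y‖) h (‖x‖⁻¹ • x)).congr ?_
  filter_upwards [h5] with t ht
  rw [ht]

/-- A radial function that is classically a solution away from the origin is a viscosity
solution there. -/
theorem isViscositySol_radial {G : ℝ → ℝ} {Ω : Set (E n)} {g'' : ℝ → ℝ}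
    (h0 : ∀ x ∈ Ω, x ≠ 0) (h1 : ∀ r, 0 < r → HasDerivAt g (g' r) r)
    (h2 : ∀ r, 0 < r → HasDerivAt g' (g'' r) r)
    (heq : ∀ r, 0 < r → g' r ^ 2 * g'' r = G (g r)) :
    IsViscositySol G Ω (fun x => g ‖x‖) := by
  have hc : ContinuousOn (fun x : E n => g ‖x‖) Ω := fun x hx =>
    (hasFDerivAt_radial (h0 x hx) (h1 _ (norm_pos_iff.mpr (h0 x hx)))).continuousAt.continuousWithinAt
  have hev : ∀ x ∈ Ω, ∀ᶠ r in 𝓝 ‖x‖, HasDerivAt g (g' r) r := fun x hx =>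
    (lt_mem_nhds (norm_pos_iff.mpr (h0 x hx))).mono h1
  refine ⟨⟨hc, fun x hx φ hφ h => ?_⟩, ⟨hc, fun x hx φ hφ h => ?_⟩⟩
  · have hp := norm_pos_iff.mpr (h0 x hx)
    rw [← heq _ hp]
    exact radial_le_infLaplacian (h0 x hx) (hev x hx) (h2 _ hp) hφ h
  · have hp := norm_pos_iff.mpr (h0 x hx)
    rw [← heq _ hp]
    exact infLaplacian_le_radial (h0 x hx) (hev x hx) (h2 _ hp) hφ h

end Radial

/-! ### Touching supersolutions from below -/

/-- Supersolutions tested with quadratic functions of one linear coordinate. -/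
theorem IsViscositySuper.quadratic_test {G : ℝ → ℝ} {Ω : Set (E n)} {w : E n → ℝ}
    (hw : IsViscositySuper G Ω w) {x e : E n} (hx : x ∈ Ω) (he : ‖e‖ = 1) {p M : ℝ}
    (h : ∀ᶠ y in 𝓝 x, p * inner ℝ e (y - x) + M / 2 * inner ℝ e (y - x) ^ 2 ≤ w y - w x) :
    p ^ 2 * M ≤ G (w x) := by
  set φ : E n → ℝ := fun y => p * inner ℝ e (y - x) + M / 2 * inner ℝ e (y - x) ^ 2 with hφdef
  have hφ : ContDiff ℝ 2 φ := by
    have h1 : ContDiff ℝ 2 fun y : E n => inner ℝ e (y - x) :=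
      contDiff_const.inner ℝ (contDiff_id.sub contDiff_const)
    exact (contDiff_const.mul h1).add (contDiff_const.mul (h1.pow 2))
  have hfd : fderiv ℝ φ x = p • innerSL ℝ e := by
    have h1 : HasFDerivAt (fun y : E n => inner ℝ e (y - x)) (innerSL ℝ e) x := by
      have := (innerSL ℝ e).hasFDerivAt.comp x ((hasFDerivAt_id x).sub_const x)
      simpa [Function.comp_def] using this
    have h2 := (h1.const_mul p).add ((h1.pow 2).const_mul (M / 2))
    refine h2.fderiv.trans ?_
    simp
  have hM : M ≤ fderiv ℝ (fderiv ℝ φ) x e e := by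
    refine le_second_fderiv_of_isLocalMin (k := fun t => p * t + M / 2 * t ^ 2)
      (k' := fun t => p + M * t) hφ.contDiffAt ?_ ?_ ?_
    · refine Eventually.of_forall fun t => ?_
      have := ((hasDerivAt_id t).const_mul p).add ((hasDerivAt_pow 2 t).const_mul (M / 2))
      refine this.congr_deriv ?_
      simp; ring
    · simpa using ((hasDerivAt_id (0 : ℝ)).const_mul M).const_add p
    · refine Eventually.of_forall fun t => ?_
      simp [hφdef, inner_smul_right, he]
  have := hw.2 x hx φ hφ.contDiffAt (by
    filter_upwards [h] with y hy
    have : φ x = 0 := by simp [hφdef]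
    rw [this]
    simp only [hφdef]
    linarith)
  rw [infLaplacian_of_fderiv_eq hfd] at this
  nlinarith [sq_nonneg p]

/-- A supersolution cannot be touched from below by a radial increasing function which is a
strict classical subsolution. -/
theorem IsViscositySuper.le_of_touching_radial {G : ℝ → ℝ} {Ω : Set (E n)} {w : E n → ℝ}
    (hw : IsViscositySuper G Ω w) {x : E n} (hxΩ : x ∈ Ω) (hx : x ≠ 0) {g g' : ℝ → ℝ} {a : ℝ}
    (h1 : ∀ᶠ r in 𝓝 ‖x‖, HasDerivAt g (g' r) r) (h2 : HasDerivAt g' a ‖x‖)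
    (hpos : 0 < g' ‖x‖) (heq : w x = g ‖x‖) (hle : ∀ᶠ y in 𝓝 x, g ‖y‖ ≤ w y) :
    g' ‖x‖ ^ 2 * a ≤ G (w x) := by
  have hr : 0 < ‖x‖ := norm_pos_iff.mpr hx
  set r := ‖x‖ with hrdef
  set e : E n := r⁻¹ • x with hedef
  have he : ‖e‖ = 1 := by
    rw [hedef, norm_smul, norm_inv, Real.norm_of_nonneg hr.le, ← hrdef, inv_mul_cancel₀ hr.ne']
  have hex : inner ℝ e x = r := by
    rw [hedef, inner_smul_left, real_inner_self_eq_norm_sq, ← hrdef]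
    simp
    field_simp
  -- near `r` the derivative is positive, so `g` is monotone there
  have hmono : ∃ d > 0, MonotoneOn g (Icc (r - d) (r + d)) := by
    have hev : ∀ᶠ s in 𝓝 r, HasDerivAt g (g' s) s ∧ 0 < g' s :=
      h1.and (h2.continuousAt.eventually (lt_mem_nhds hpos))
    obtain ⟨d, hd, hball⟩ := Metric.eventually_nhds_iff.mp hev
    refine ⟨d / 2, by positivity, ?_⟩
    have hin : ∀ s ∈ Icc (r - d / 2) (r + d / 2), HasDerivAt g (g' s) s ∧ 0 < g' s := by
      intro s hs
      apply hball
      rw [Real.dist_eq, abs_lt]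
      constructor <;> linarith [hs.1, hs.2]
    refine monotoneOn_of_deriv_nonneg (convex_Icc _ _)
      (fun s hs => (hin s hs).1.continuousAt.continuousWithinAt) ?_ ?_
    · intro s hs
      exact (hin s (interior_subset hs)).1.differentiableAt.differentiableWithinAt
    · intro s hs
      rw [(hin s (interior_subset hs)).1.deriv]
      exact (hin s (interior_subset hs)).2.le
  obtain ⟨d, hd, hmono⟩ := hmono
  -- The profile need not be `C²`, so it is not an admissible test function. A quadratic with second
  -- derivative `M < a` lies below `g` near `r`, and `inner ℝ e y ≤ ‖y‖` with monotonicity of `g`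
  -- carries this over to the radial function.
  have key : ∀ M < a, g' r ^ 2 * M ≤ G (w x) := by
    intro M hM
    have hloc : IsLocalMin (fun s => g s - (g' r * (s - r) + M / 2 * (s - r) ^ 2)) r := by
      have hder : ∀ᶠ s in 𝓝 r, HasDerivAt
          (fun s => g s - (g' r * (s - r) + M / 2 * (s - r) ^ 2))
          (g' s - (g' r + M * (s - r))) s := by
        filter_upwards [h1] with s hs
        have h3 : HasDerivAt (fun s : ℝ => s - r) 1 s := (hasDerivAt_id s).sub_const r
        have := hs.sub ((h3.const_mul (g' r)).add ((h3.pow 2).const_mul (M / 2)))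
        refine this.congr_deriv ?_
        simp; ring
      have hder2 : HasDerivAt (fun s => g' s - (g' r + M * (s - r))) (a - M) r := by
        have h3 : HasDerivAt (fun s : ℝ => s - r) 1 r := (hasDerivAt_id r).sub_const r
        exact (h2.sub ((h3.const_mul M).const_add (g' r))).congr_deriv (by simp)
      refine isLocalMin_of_deriv_deriv_pos ?_ ?_ hder.self_of_nhds.continuousAt
      · have : deriv (fun s => g s - (g' r * (s - r) + M / 2 * (s - r) ^ 2)) =ᶠ[𝓝 r]
            fun s => g' s - (g' r + M * (s - r)) := hder.mono fun s hs => hs.deriv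
        rw [this.deriv_eq, hder2.deriv]
        linarith
      · rw [hder.self_of_nhds.deriv]; simp
    refine hw.quadratic_test hxΩ he ?_
    have hcont : Tendsto (fun y : E n => inner ℝ e y) (𝓝 x) (𝓝 r) := by
      have : Continuous fun y : E n => inner ℝ e y := by fun_prop
      simpa [hex] using this.tendsto x
    have hcont' : Tendsto (fun y : E n => ‖y‖) (𝓝 x) (𝓝 r) := continuous_norm.tendsto x
    have hI : Icc (r - d) (r + d) ∈ 𝓝 r := Icc_mem_nhds (by linarith) (by linarith)
    filter_upwards [hle, hcont.eventually hloc, hcont.eventually hI, hcont'.eventually hI]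
      with y h3 h4 h5 h6
    have h7 : g (inner ℝ e y) ≤ g ‖y‖ := by
      apply hmono h5 h6
      calc inner ℝ e y ≤ ‖e‖ * ‖y‖ := real_inner_le_norm _ _
        _ = ‖y‖ := by rw [he, one_mul]
    rw [inner_sub_right, hex]
    simp only [sub_self, mul_zero, ne_eq, OfNat.ofNat_ne_zero, not_false_eq_true, zero_pow,
      add_zero, sub_zero] at h4
    linarith
  by_contra! hcon
  have hg2 : 0 < g' r ^ 2 := by positivity
  -- This `M` places `g' r ^ 2 * M` halfway between `G (w x)` and `g' r ^ 2 * a`.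
  have h3 := key (a - (g' r ^ 2 * a - G (w x)) / (2 * g' r ^ 2)) (by
    have : 0 < (g' r ^ 2 * a - G (w x)) / (2 * g' r ^ 2) := by
      apply div_pos <;> linarith
    linarith)
  have h4 : g' r ^ 2 * (a - (g' r ^ 2 * a - G (w x)) / (2 * g' r ^ 2))
      = g' r ^ 2 * a - (g' r ^ 2 * a - G (w x)) / 2 := by field_simp
  linarith

/-- A supersolution cannot have a convex kink. -/
theorem IsViscositySuper.not_kink {G : ℝ → ℝ} {Ω : Set (E n)} {w : E n → ℝ}
    (hw : IsViscositySuper G Ω w) {x e : E n} (hx : x ∈ Ω) (he : ‖e‖ = 1) {p : ℝ} (hp : 0 < p)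
    (h : ∀ᶠ y in 𝓝 x, p * |inner ℝ e (y - x)| ≤ w y - w x) : False := by
  -- With slope `p / 2` a parabola of any curvature `M` fits under the kink where the coordinate is
  -- below `p / M`. This `M` gives `(p / 2)² M = |G (w x)| + 1`, which violates the supersolution
  -- inequality.
  set M : ℝ := (|G (w x)| + 1) * 4 / p ^ 2 with hM
  have hMpos : 0 < M := by positivity
  have := hw.quadratic_test hx he (p := p / 2) (M := M) (by
    have hc : Tendsto (fun y : E n => |inner ℝ e (y - x)|) (𝓝 x) (𝓝 0) := by
      have : Continuous fun y : E n => |inner ℝ e (y - x)| := by fun_prop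
      simpa using this.tendsto x
    filter_upwards [h, hc.eventually (gt_mem_nhds (show (0 : ℝ) < p / M by positivity))]
      with y h1 h2
    refine le_trans ?_ h1
    rw [lt_div_iff₀ hMpos] at h2
    have h3 := le_abs_self (inner ℝ e (y - x))
    have h4 := abs_nonneg (inner ℝ e (y - x))
    rw [← sq_abs (inner ℝ e (y - x))]
    nlinarith)
  have h2 : (p / 2) ^ 2 * M = |G (w x)| + 1 := by rw [hM]; field_simp; ring
  rw [h2] at this
  linarith [le_abs_self (G (w x))]

/-! ### The profile equation: existence, a priori bounds and compactness -/

/-- `g` is a radial profile on `[0, ρ]`: with `P = (g')³`, it solves `P' = 3 h(g)`, that is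
`(g')² g'' = h(g)`, with `g(0) = v` and `g'(0)³ = q`. -/
structure IsProfile (h : ℝ → ℝ) (q v ρ : ℝ) (g P : ℝ → ℝ) : Prop where
  init_val : g 0 = v
  init_slope : P 0 = q
  deriv_val : ∀ r ∈ Icc 0 ρ, HasDerivWithinAt g (P r ^ (1 / 3 : ℝ)) (Icc 0 ρ) r
  deriv_slope : ∀ r ∈ Icc 0 ρ, HasDerivWithinAt P (3 * h (g r)) (Icc 0 ρ) r

/-- The one-sided bounds on profiles come from applying this to a difference of the two quantities
compared. -/
theorem monotoneOn_Icc_of_hasDerivWithinAt {f f' : ℝ → ℝ} {ρ : ℝ}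
    (h : ∀ r ∈ Icc 0 ρ, HasDerivWithinAt f (f' r) (Icc 0 ρ) r) (h0 : ∀ r ∈ Icc 0 ρ, 0 ≤ f' r) :
    MonotoneOn f (Icc 0 ρ) :=
  monotoneOn_of_hasDerivWithinAt_nonneg (convex_Icc 0 ρ) (fun r hr => (h r hr).continuousWithinAt)
    (fun r hr => (h r (interior_subset hr)).mono interior_subset)
    (fun r hr => h0 r (interior_subset hr))

/-- Picard–Lindelöf on the whole interval at once: a field bounded by `L` cannot leave the ball of
radius `L * ρ` in time `ρ`. -/
theorem exists_solution_of_bounded_lipschitz {F : Type*} [NormedAddCommGroup F] [NormedSpace ℝ F]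
    [CompleteSpace F] {X : F → F} {K L : NNReal} (hK : LipschitzWith K X) (hL : ∀ z, ‖X z‖ ≤ L)
    {ρ : ℝ} (hρ : 0 ≤ ρ) (z₀ : F) :
    ∃ z : ℝ → F, z 0 = z₀ ∧ ∀ t ∈ Icc 0 ρ, HasDerivWithinAt z (X (z t)) (Icc 0 ρ) t := by
  have hPL : IsPicardLindelof (fun _ => X) (tmin := 0) (tmax := ρ) ⟨0, left_mem_Icc.mpr hρ⟩ z₀
      (L * ⟨ρ, hρ⟩) 0 L K :=
    { lipschitzOnWith := fun t _ => hK.lipschitzOnWith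
      continuousOn := fun x _ => continuousOn_const
      norm_le := fun t _ x _ => hL x
      mul_max_le := by
        simp only [sub_zero, sub_self, NNReal.coe_zero]
        rw [max_eq_left hρ]
        exact le_rfl }
  obtain ⟨z, hz0, hz⟩ := hPL.exists_eq_forall_mem_Icc_hasDerivWithinAt₀
  exact ⟨z, hz0, hz⟩

/-- The derivative of the cube root is largest at the left end `q` and blows up as `q → 0`. This is
why profiles are first built with positive initial slope. -/
theorem abs_cbrt_sub_le {q x y : ℝ} (hq : 0 < q) (hx : q ≤ x) (hy : q ≤ y) :
    |x ^ (1 / 3 : ℝ) - y ^ (1 / 3 : ℝ)| ≤ (1 / 3) * q ^ (-(2 / 3) : ℝ) * |x - y| := by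
  refine Convex.norm_image_sub_le_of_norm_hasDerivWithin_le (f := fun x : ℝ => x ^ (1 / 3 : ℝ))
    (f' := fun x => (1 / 3) * x ^ ((1 / 3 : ℝ) - 1)) (s := Ici q) ?_ ?_ (convex_Ici q) hy hx
  · intro z hz
    exact (Real.hasDerivAt_rpow_const (Or.inl (hq.trans_le hz).ne')).hasDerivWithinAt
  · intro z hz
    have hz0 : 0 < z := hq.trans_le hz
    rw [Real.norm_of_nonneg (by positivity)]
    have : (1 / 3 : ℝ) - 1 = -(2 / 3) := by norm_num
    rw [this]
    exact mul_le_mul_of_nonneg_left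
      (Real.rpow_le_rpow_of_nonpos hq hz (by norm_num)) (by norm_num)

/-- Profiles with positive initial slope exist for every initial value, and depend on it in a
Lipschitz way. -/
theorem exists_profile_family {h : ℝ → ℝ} {K : NNReal} (hK : LipschitzWith K h) {M : ℝ}
    (h0 : ∀ s, 0 ≤ h s) (hM : ∀ s, h s ≤ M) {q ρ : ℝ} (hq : 0 < q) (hρ : 0 ≤ ρ) :
    ∃ g P : ℝ → ℝ → ℝ, (∀ v, IsProfile h q v ρ (g v) (P v)) ∧
      ∃ D : ℝ, ∀ v v', ∀ r ∈ Icc 0 ρ, |g v r - g v' r| ≤ D * |v - v'| := by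
  have hM0 : 0 ≤ M := (h0 0).trans (hM 0)
  set Q : ℝ := q + 3 * M * ρ with hQ
  have hqQ : q ≤ Q := by rw [hQ]; nlinarith [mul_nonneg hM0 hρ]
  -- Truncating `P` to `[q, Q]` makes the field bounded and Lipschitz. The bounds `hPl` and `hPu`
  -- show afterwards that the truncation is never active, and Grönwall gives `D = exp (K' ρ)`.
  set κ : ℝ → ℝ := fun p => (max q (min p Q)) ^ (1 / 3 : ℝ) with hκ
  have hκLip : LipschitzWith (Real.toNNReal ((1 / 3) * q ^ (-(2 / 3) : ℝ))) κ := by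
    refine LipschitzWith.of_dist_le_mul fun x y => ?_
    rw [Real.dist_eq, Real.dist_eq, Real.coe_toNNReal _ (by positivity)]
    refine (abs_cbrt_sub_le hq (le_max_left _ _) (le_max_left _ _)).trans ?_
    refine mul_le_mul_of_nonneg_left ?_ (by positivity)
    refine (abs_max_sub_max_le_max _ _ _ _).trans ?_
    rw [sub_self, abs_zero, max_eq_right (abs_nonneg _)]
    refine (abs_min_sub_min_le_max _ _ _ _).trans ?_
    rw [sub_self, abs_zero, max_eq_left (abs_nonneg _)]
  set X : ℝ × ℝ → ℝ × ℝ := fun z => (κ z.2, 3 * h z.1) with hX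
  obtain ⟨K', hK'⟩ : ∃ K', LipschitzWith K' X := by
    have h3 : LipschitzWith (3 * K) fun s => 3 * h s := by
      refine LipschitzWith.of_dist_le_mul fun x y => ?_
      have := hK.dist_le_mul x y
      rw [Real.dist_eq] at this ⊢
      rw [← mul_sub, abs_mul, abs_of_pos (by norm_num : (0 : ℝ) < 3)]
      push_cast
      linarith
    exact ⟨_, (hκLip.comp LipschitzWith.prod_snd).prodMk (h3.comp LipschitzWith.prod_fst)⟩
  set L : NNReal := ⟨max (Q ^ (1 / 3 : ℝ)) (3 * M), le_max_of_le_right (by positivity)⟩ with hL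
  have hLb : ∀ z, ‖X z‖ ≤ L := by
    intro z
    rw [Prod.norm_def]
    refine max_le_max ?_ ?_
    · have : 0 < max q (min z.2 Q) := lt_max_of_lt_left hq
      rw [Real.norm_of_nonneg (by simp only [hX, hκ]; positivity)]
      exact Real.rpow_le_rpow this.le (max_le hqQ (min_le_right _ _)) (by norm_num)
    · rw [Real.norm_of_nonneg (by simp only [hX]; linarith [h0 z.1])]
      simp only [hX]
      linarith [hM z.1]
  choose z hz0 hz using fun v => exists_solution_of_bounded_lipschitz hK' hLb hρ ((v, q) : ℝ × ℝ)
  have hg : ∀ v, ∀ r ∈ Icc 0 ρ,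
      HasDerivWithinAt (fun r => (z v r).1) (κ (z v r).2) (Icc 0 ρ) r := fun v r hr =>
    (ContinuousLinearMap.fst ℝ ℝ ℝ).hasFDerivAt.comp_hasDerivWithinAt r (hz v r hr)
  have hP : ∀ v, ∀ r ∈ Icc 0 ρ,
      HasDerivWithinAt (fun r => (z v r).2) (3 * h (z v r).1) (Icc 0 ρ) r := fun v r hr =>
    (ContinuousLinearMap.snd ℝ ℝ ℝ).hasFDerivAt.comp_hasDerivWithinAt r (hz v r hr)
  have hz02 : ∀ v, (z v 0).2 = q := fun v => by rw [hz0]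
  have hPl : ∀ v, ∀ r ∈ Icc 0 ρ, q ≤ (z v r).2 := by
    intro v r hr
    have := monotoneOn_Icc_of_hasDerivWithinAt (hP v) (fun r _ => by linarith [h0 (z v r).1])
      (left_mem_Icc.mpr hρ) hr hr.1
    simpa only [hz02] using this
  have hPu : ∀ v, ∀ r ∈ Icc 0 ρ, (z v r).2 ≤ Q := by
    intro v r hr
    have := monotoneOn_Icc_of_hasDerivWithinAt
      (fun r hr => (((hasDerivAt_id r).const_mul (3 * M)).hasDerivWithinAt).sub (hP v r hr))
      (fun r _ => by linarith [hM (z v r).1]) (left_mem_Icc.mpr hρ) hr hr.1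
    simp only [Pi.sub_apply, id, hz02, mul_zero, zero_sub] at this
    rw [hQ]
    nlinarith [mul_le_mul_of_nonneg_left hr.2 hM0]
  refine ⟨fun v r => (z v r).1, fun v r => (z v r).2, fun v => ⟨by simp [hz0], hz02 v, ?_, hP v⟩,
    Real.exp (K' * ρ), ?_⟩
  · intro r hr
    have := hg v r hr
    simp only [hκ] at this
    rwa [min_eq_left (hPu v r hr), max_eq_right (hPl v r hr)] at this
  · intro v v' r hr
    have hIci : ∀ v, ∀ t ∈ Ico 0 ρ, HasDerivWithinAt (z v) (X (z v t)) (Ici t) t := fun v t ht =>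
      (hz v t (Ico_subset_Icc_self ht)).mono_of_mem_nhdsWithin
        (mem_of_superset (Icc_mem_nhdsGE ht.2) (Icc_subset_Icc_left ht.1))
    have hcont : ∀ v, ContinuousOn (z v) (Icc 0 ρ) := fun v t ht =>
      (hz v t ht).continuousWithinAt
    have h1 := dist_le_of_trajectories_ODE (δ := |v - v'|) (fun _ => hK') (hcont v) (hIci v)
      (hcont v') (hIci v')
      (by rw [hz0, hz0, Prod.dist_eq]; simp [Real.dist_eq]) r hr
    have h2 : |(z v r).1 - (z v' r).1| ≤ dist (z v r) (z v' r) := by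
      rw [Prod.dist_eq, ← Real.dist_eq]
      exact le_max_left _ _
    refine h2.trans (h1.trans ?_)
    rw [mul_comm]
    refine mul_le_mul_of_nonneg_right ?_ (abs_nonneg _)
    rw [sub_zero]
    exact Real.exp_le_exp.mpr (mul_le_mul_of_nonneg_left hr.2 K'.2)

/-- Arzelà–Ascoli on `[0, ρ]`: the functions with the given Lipschitz constant and bound form a
compact set. -/
theorem exists_subseq_tendsto_of_lipschitz {ρ : ℝ} {F : Type*} [NormedAddCommGroup F]
    [ProperSpace F] {L : NNReal} {C : ℝ} {z : ℕ → ℝ → F}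
    (hL : ∀ k, LipschitzOnWith L (z k) (Icc 0 ρ)) (hC : ∀ k, ∀ r ∈ Icc 0 ρ, ‖z k r‖ ≤ C) :
    ∃ (φ : ℕ → ℕ) (y : ℝ → F), StrictMono φ ∧ LipschitzOnWith L y (Icc 0 ρ) ∧
      ∀ r ∈ Icc 0 ρ, Tendsto (fun k => z (φ k) r) atTop (𝓝 (y r)) := by
  let A : Set (BoundedContinuousFunction (Icc (0 : ℝ) ρ) F) :=
    {u | (∀ r s, dist (u r) (u s) ≤ L * dist r s) ∧ ∀ r, u r ∈ Metric.closedBall (0 : F) C}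
  have hAcl : IsClosed A := by
    have : A = (⋂ r, ⋂ s, {u | dist (u r) (u s) ≤ L * dist r s}) ∩
        ⋂ r, {u | u r ∈ Metric.closedBall (0 : F) C} := by
      ext u; simp only [A, mem_ofPred_eq, mem_inter_iff, mem_iInter]
    rw [this]
    refine (isClosed_iInter fun r => isClosed_iInter fun s => ?_).inter (isClosed_iInter fun r => ?_)
    · exact isClosed_le ((continuous_eval_const r).dist
        (continuous_eval_const s)) continuous_const
    · exact Metric.isClosed_closedBall.preimage (continuous_eval_const r)
  have hA : IsCompact A := by
    refine BoundedContinuousFunction.arzela_ascoli₂ (Metric.closedBall (0 : F) C)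
      (isCompact_closedBall _ _) A hAcl (fun u r hu => hu.2 r) ?_
    refine LipschitzWith.uniformEquicontinuous (K := L) _ (fun u => ?_) |>.equicontinuous
    exact LipschitzWith.of_dist_le_mul u.2.1
  let u : ℕ → BoundedContinuousFunction (Icc (0 : ℝ) ρ) F := fun k =>
    BoundedContinuousFunction.mkOfCompact ⟨(Icc 0 ρ).domRestrict (z k),
      (hL k).continuousOn.domRestrict⟩
  have hu : ∀ k, u k ∈ A := fun k =>
    ⟨fun r s => (hL k).dist_le_mul r r.2 s s.2, fun r => by
      rw [mem_closedBall_zero_iff]; exact hC k r r.2⟩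
  obtain ⟨w, hw, φ, hφ, hlim⟩ := hA.tendsto_subseq hu
  classical
  refine ⟨φ, fun r => if h : r ∈ Icc 0 ρ then w ⟨r, h⟩ else 0, hφ, ?_, ?_⟩
  · refine LipschitzOnWith.of_dist_le_mul fun r hr s hs => ?_
    rw [dif_pos hr, dif_pos hs]
    exact hw.1 ⟨r, hr⟩ ⟨s, hs⟩
  · intro r hr
    simp only [dif_pos hr]
    exact ((continuous_eval_const (⟨r, hr⟩ : Icc (0 : ℝ) ρ)).tendsto w).comp hlim

theorem tendsto_integral_comp_of_tendsto {ρ : ℝ} {H : ℝ → ℝ}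
    (hH : Continuous H) {C : ℝ} {x : ℕ → ℝ → ℝ} {y : ℝ → ℝ}
    (hx : ∀ k, ContinuousOn (x k) (Icc 0 ρ)) (hC : ∀ k, ∀ r ∈ Icc 0 ρ, |H (x k r)| ≤ C)
    (hlim : ∀ r ∈ Icc 0 ρ, Tendsto (fun k => x k r) atTop (𝓝 (y r))) {r : ℝ} (hr : r ∈ Icc 0 ρ) :
    Tendsto (fun k => ∫ s in (0 : ℝ)..r, H (x k s)) atTop (𝓝 (∫ s in (0 : ℝ)..r, H (y s))) := by
  have hsub : ∀ s ∈ uIoc 0 r, s ∈ Icc 0 ρ := by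
    intro s hs
    rw [uIoc_of_le hr.1] at hs
    exact ⟨hs.1.le, hs.2.trans hr.2⟩
  refine intervalIntegral.tendsto_integral_filter_of_dominated_convergence (fun _ => C) ?_ ?_ ?_ ?_
  · refine Eventually.of_forall fun k => ?_
    refine ContinuousOn.aestronglyMeasurable ?_ measurableSet_uIoc
    exact hH.comp_continuousOn ((hx k).mono hsub)
  · exact Eventually.of_forall fun k => MeasureTheory.ae_of_all _ fun s hs => hC k s (hsub s hs)
  · exact intervalIntegrable_const
  · exact MeasureTheory.ae_of_all _ fun s hs => (hH.tendsto _).comp (hlim s (hsub s hs))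

/-- The integral form of the equation survives pointwise limits; this lemma then recovers the
differential form. Extending `G` constantly beyond the interval lets the fundamental theorem apply
at the endpoints too. -/
theorem hasDerivWithinAt_of_eq_integral {ρ : ℝ} (hρ : 0 ≤ ρ) {g G : ℝ → ℝ} {c : ℝ}
    (hG : ContinuousOn G (Icc 0 ρ)) (hg : ∀ r ∈ Icc 0 ρ, g r = c + ∫ s in (0 : ℝ)..r, G s) :
    ∀ r ∈ Icc 0 ρ, HasDerivWithinAt g (G r) (Icc 0 ρ) r := by
  intro r hr
  set G' : ℝ → ℝ := IccExtend hρ ((Icc 0 ρ).domRestrict G)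
  have hG' : Continuous G' := hG.domRestrict.Icc_extend'
  have heq : ∀ s ∈ Icc 0 ρ, G' s = G s := fun s hs => IccExtend_of_mem hρ _ hs
  have h1 : HasDerivAt (fun r => c + ∫ s in (0 : ℝ)..r, G' s) (G' r) r :=
    (intervalIntegral.integral_hasDerivAt_right (hG'.intervalIntegrable _ _)
      (hG'.stronglyMeasurableAtFilter _ _) hG'.continuousAt).const_add c
  rw [← heq r hr]
  have h2 : ∀ s ∈ Icc 0 ρ, g s = c + ∫ s in (0 : ℝ)..s, G' s := by
    intro s hs
    rw [hg s hs]
    congr 1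
    refine intervalIntegral.integral_congr fun t ht => (heq t ?_).symm
    rw [uIcc_of_le hs.1] at ht
    exact ⟨ht.1, ht.2.trans hs.2⟩
  exact h1.hasDerivWithinAt.congr h2 (h2 r hr)

theorem eq_integral_of_hasDerivWithinAt {ρ : ℝ} {g G : ℝ → ℝ} (hG : ContinuousOn G (Icc 0 ρ))
    (hg : ∀ r ∈ Icc 0 ρ, HasDerivWithinAt g (G r) (Icc 0 ρ) r) :
    ∀ r ∈ Icc 0 ρ, g r = g 0 + ∫ s in (0 : ℝ)..r, G s := by
  intro r hr
  have hsub : Icc 0 r ⊆ Icc 0 ρ := Icc_subset_Icc_right hr.2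
  have := intervalIntegral.integral_eq_sub_of_hasDeriv_right_of_le (f := g) (f' := G) hr.1
    (fun s hs => ((hg s (hsub hs)).continuousWithinAt).mono hsub) (fun s hs => ?_)
    ((hG.mono (by rw [uIcc_of_le hr.1]; exact hsub)).intervalIntegrable)
  · rw [this]; ring
  · exact ((hg s (hsub (Ioo_subset_Icc_self hs))).hasDerivAt
      (Icc_mem_nhds hs.1 (hs.2.trans_le hr.2))).hasDerivWithinAt

namespace IsProfile

variable {h : ℝ → ℝ} {q v ρ M : ℝ} {g P : ℝ → ℝ}

theorem continuousOn_val (hp : IsProfile h q v ρ g P) : ContinuousOn g (Icc 0 ρ) :=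
  fun r hr => (hp.deriv_val r hr).continuousWithinAt

theorem continuousOn_slope (hp : IsProfile h q v ρ g P) : ContinuousOn P (Icc 0 ρ) :=
  fun r hr => (hp.deriv_slope r hr).continuousWithinAt

theorem monotoneOn_slope (hp : IsProfile h q v ρ g P) (h0 : ∀ s, 0 ≤ h s) :
    MonotoneOn P (Icc 0 ρ) :=
  monotoneOn_Icc_of_hasDerivWithinAt hp.deriv_slope fun r _ => by linarith [h0 (g r)]

theorem le_slope (hp : IsProfile h q v ρ g P) (h0 : ∀ s, 0 ≤ h s) {r : ℝ} (hr : r ∈ Icc 0 ρ) :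
    q ≤ P r := by
  rw [← hp.init_slope]
  exact hp.monotoneOn_slope h0 (left_mem_Icc.mpr (hr.1.trans hr.2)) hr hr.1

theorem slope_le (hp : IsProfile h q v ρ g P) (hM : ∀ s, h s ≤ M) {r : ℝ} (hr : r ∈ Icc 0 ρ) :
    P r ≤ q + 3 * M * r := by
  have := monotoneOn_Icc_of_hasDerivWithinAt
    (fun r hr => (((hasDerivAt_id r).const_mul (3 * M)).hasDerivWithinAt).sub (hp.deriv_slope r hr))
    (fun r _ => by linarith [hM (g r)]) (left_mem_Icc.mpr (hr.1.trans hr.2)) hr hr.1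
  simp only [Pi.sub_apply, id, hp.init_slope, mul_zero, zero_sub] at this
  linarith

theorem monotoneOn_val (hp : IsProfile h q v ρ g P) (hq : 0 ≤ q) (h0 : ∀ s, 0 ≤ h s) :
    MonotoneOn g (Icc 0 ρ) :=
  monotoneOn_Icc_of_hasDerivWithinAt hp.deriv_val fun _ hr =>
    Real.rpow_nonneg (hq.trans (hp.le_slope h0 hr)) _

theorem le_val (hp : IsProfile h q v ρ g P) (hq : 0 ≤ q) (h0 : ∀ s, 0 ≤ h s) {r : ℝ}
    (hr : r ∈ Icc 0 ρ) : v ≤ g r := by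
  rw [← hp.init_val]
  exact hp.monotoneOn_val hq h0 (left_mem_Icc.mpr (hr.1.trans hr.2)) hr hr.1

theorem cbrt_slope_le (hp : IsProfile h q v ρ g P) (hq : 0 ≤ q) (h0 : ∀ s, 0 ≤ h s)
    (hM : ∀ s, h s ≤ M) {r : ℝ} (hr : r ∈ Icc 0 ρ) :
    P r ^ (1 / 3 : ℝ) ≤ (q + 3 * M * ρ) ^ (1 / 3 : ℝ) := by
  have hM0 : 0 ≤ M := (h0 0).trans (hM 0)
  refine Real.rpow_le_rpow (hq.trans (hp.le_slope h0 hr)) ?_ (by norm_num)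
  refine (hp.slope_le hM hr).trans ?_
  gcongr
  exact hr.2

theorem val_le (hp : IsProfile h q v ρ g P) (hq : 0 ≤ q) (h0 : ∀ s, 0 ≤ h s)
    (hM : ∀ s, h s ≤ M) {r : ℝ} (hr : r ∈ Icc 0 ρ) :
    g r ≤ v + (q + 3 * M * ρ) ^ (1 / 3 : ℝ) * r := by
  have := monotoneOn_Icc_of_hasDerivWithinAt
    (fun r hr => (((hasDerivAt_id r).const_mul
      ((q + 3 * M * ρ) ^ (1 / 3 : ℝ))).hasDerivWithinAt).sub (hp.deriv_val r hr))
    (fun r hr => by linarith [hp.cbrt_slope_le hq h0 hM hr])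
    (left_mem_Icc.mpr (hr.1.trans hr.2)) hr hr.1
  simp only [Pi.sub_apply, id, hp.init_val, mul_zero, zero_sub] at this
  linarith

end IsProfile

/-- Stability of profiles under perturbation of the equation and of the initial data. -/
theorem exists_profile_limit {f : ℝ → ℝ} (hf : Continuous f) {M : ℝ} (h0 : ∀ s, 0 ≤ f s)
    (hM : ∀ s, f s ≤ M) {ρ : ℝ} (hρ : 0 ≤ ρ) {q η v : ℕ → ℝ} {q₀ C : ℝ}
    (hq0 : ∀ k, 0 ≤ q k) (hq1 : ∀ k, q k ≤ 1) (hη0 : ∀ k, 0 ≤ η k) (hη1 : ∀ k, η k ≤ 1)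
    (hq : Tendsto q atTop (𝓝 q₀)) (hη : Tendsto η atTop (𝓝 0)) (hv : ∀ k, |v k| ≤ C)
    {g P : ℕ → ℝ → ℝ}
    (hp : ∀ k, IsProfile (fun s => f s + η k) (q k) (v k) ρ (g k) (P k)) :
    ∃ (φ : ℕ → ℕ) (v' : ℝ) (g' P' : ℝ → ℝ), StrictMono φ ∧ IsProfile f q₀ v' ρ g' P' ∧
      ∀ r ∈ Icc 0 ρ, Tendsto (fun k => g (φ k) r) atTop (𝓝 (g' r)) := by
  have hM0 : 0 ≤ M := (h0 0).trans (hM 0)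
  have hk0 : ∀ k s, 0 ≤ f s + η k := fun k s => add_nonneg (h0 s) (hη0 k)
  have hkM : ∀ k s, f s + η k ≤ M + 1 := fun k s => add_le_add (hM s) (hη1 k)
  set Q : ℝ := 1 + 3 * (M + 1) * ρ with hQ
  have hQ0 : 0 ≤ Q := by positivity
  have hslope : ∀ k, ∀ r ∈ Icc 0 ρ, P k r ^ (1 / 3 : ℝ) ≤ Q ^ (1 / 3 : ℝ) := by
    intro k r hr
    refine ((hp k).cbrt_slope_le (hq0 k) (hk0 k) (hkM k) hr).trans ?_
    refine Real.rpow_le_rpow (by have := hq0 k; positivity) ?_ (by norm_num)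
    rw [hQ]
    linarith [hq1 k]
  have hP0 : ∀ k, ∀ r ∈ Icc 0 ρ, 0 ≤ P k r := fun k r hr =>
    (hq0 k).trans ((hp k).le_slope (hk0 k) hr)
  have hPQ : ∀ k, ∀ r ∈ Icc 0 ρ, P k r ≤ Q := by
    intro k r hr
    refine ((hp k).slope_le (hkM k) hr).trans ?_
    have := hr.2
    rw [hQ]
    have := mul_le_mul_of_nonneg_left hr.2 (show (0 : ℝ) ≤ 3 * (M + 1) by positivity)
    linarith [hq1 k]
  set Lr : ℝ := max (Q ^ (1 / 3 : ℝ)) (3 * (M + 1)) with hLr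
  have hLr0 : 0 ≤ Lr := le_max_of_le_right (by positivity)
  -- For `q₀ = 0` the field is no longer Lipschitz, so continuous dependence is unavailable. The
  -- pairs `(g k, P k)` are bounded and Lipschitz uniformly in `k`, and compactness takes its place.
  obtain ⟨φ, y, hφ, hy, hlim⟩ := exists_subseq_tendsto_of_lipschitz (ρ := ρ)
    (L := Lr.toNNReal) (C := max (C + Q ^ (1 / 3 : ℝ) * ρ) Q) (z := fun k r => (g k r, P k r))
    (fun k => by
      refine (convex_Icc 0 ρ).lipschitzOnWith_of_nnnorm_hasDerivWithin_le
        (f' := fun r => (P k r ^ (1 / 3 : ℝ), 3 * (f (g k r) + η k)))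
        (fun r hr => ((hp k).deriv_val r hr).prodMk ((hp k).deriv_slope r hr)) ?_
      intro r hr
      rw [← NNReal.coe_le_coe, Real.coe_toNNReal _ hLr0, coe_nnnorm, Prod.norm_def]
      refine max_le_max ?_ ?_
      · rw [Real.norm_of_nonneg (Real.rpow_nonneg (hP0 k r hr) _)]
        exact hslope k r hr
      · rw [Real.norm_of_nonneg (by linarith [hk0 k (g k r)])]
        linarith [hkM k (g k r)])
    (fun k r hr => by
      rw [Prod.norm_def]
      refine max_le_max ?_ ?_
      · rw [Real.norm_eq_abs, abs_le]
        have h1 := abs_le.mp (hv k)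
        have h2 : 0 ≤ Q ^ (1 / 3 : ℝ) * ρ := by positivity
        have h3 := (hp k).le_val (hq0 k) (hk0 k) hr
        have h4 := (hp k).val_le (hq0 k) (hk0 k) (hkM k) hr
        have h5 : (q k + 3 * (M + 1) * ρ) ^ (1 / 3 : ℝ) * r ≤ Q ^ (1 / 3 : ℝ) * ρ := by
          have := hq0 k
          gcongr
          · exact hr.1
          · rw [hQ]; linarith [hq1 k]
          · exact hr.2
        constructor <;> linarith
      · rw [Real.norm_of_nonneg (hP0 k r hr)]
        exact hPQ k r hr)
  have hlim1 : ∀ r ∈ Icc 0 ρ, Tendsto (fun k => g (φ k) r) atTop (𝓝 (y r).1) := fun r hr =>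
    (continuous_fst.tendsto _).comp (hlim r hr)
  have hlim2 : ∀ r ∈ Icc 0 ρ, Tendsto (fun k => P (φ k) r) atTop (𝓝 (y r).2) := fun r hr =>
    (continuous_snd.tendsto _).comp (hlim r hr)
  have hc1 : ContinuousOn (fun r => (y r).1) (Icc 0 ρ) :=
    continuous_fst.comp_continuousOn hy.continuousOn
  have hc2 : ContinuousOn (fun r => (y r).2) (Icc 0 ρ) :=
    continuous_snd.comp_continuousOn hy.continuousOn
  have hcb : Continuous fun s : ℝ => s ^ (1 / 3 : ℝ) :=
    Real.continuous_rpow_const (by norm_num)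
  have h0mem : (0 : ℝ) ∈ Icc 0 ρ := left_mem_Icc.mpr hρ
  have hy2 : (y 0).2 = q₀ := by
    refine tendsto_nhds_unique (hlim2 0 h0mem) ?_
    simp only [(hp _).init_slope]
    exact hq.comp hφ.tendsto_atTop
  refine ⟨φ, (y 0).1, fun r => (y r).1, fun r => (y r).2, hφ, ⟨rfl, hy2, ?_, ?_⟩, hlim1⟩
  · refine hasDerivWithinAt_of_eq_integral (c := (y 0).1) hρ (hcb.comp_continuousOn hc2) ?_
    intro r hr
    refine tendsto_nhds_unique (hlim1 r hr) ?_
    have h1 : ∀ k, g (φ k) r = g (φ k) 0 + ∫ s in (0 : ℝ)..r, P (φ k) s ^ (1 / 3 : ℝ) := fun k =>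
      eq_integral_of_hasDerivWithinAt (hcb.comp_continuousOn (hp _).continuousOn_slope)
        (hp _).deriv_val r hr
    simp only [h1]
    refine (hlim1 0 h0mem).add ?_
    refine tendsto_integral_comp_of_tendsto (C := Q ^ (1 / 3 : ℝ)) hcb
      (fun k => (hp (φ k)).continuousOn_slope) ?_ hlim2 hr
    intro k r hr
    rw [abs_of_nonneg (Real.rpow_nonneg (hP0 _ r hr) _)]
    exact hslope _ r hr
  · refine hasDerivWithinAt_of_eq_integral (c := q₀) hρ
      (continuousOn_const.mul (hf.comp_continuousOn hc1)) ?_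
    intro r hr
    refine tendsto_nhds_unique (hlim2 r hr) ?_
    have h1 : ∀ k, P (φ k) r
        = q (φ k) + ((∫ s in (0 : ℝ)..r, 3 * f (g (φ k) s)) + r * (3 * η (φ k))) := by
      intro k
      have hcf : ContinuousOn (fun s => f (g (φ k) s)) (Icc 0 ρ) :=
        hf.comp_continuousOn (hp (φ k)).continuousOn_val
      have h2 := eq_integral_of_hasDerivWithinAt (G := fun s => 3 * (f (g (φ k) s) + η (φ k)))
        (continuousOn_const.mul (hcf.add continuousOn_const)) (hp (φ k)).deriv_slope r hr
      rw [h2, (hp (φ k)).init_slope]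
      congr 1
      simp only [mul_add]
      rw [intervalIntegral.integral_add, intervalIntegral.integral_const, sub_zero, smul_eq_mul]
      · refine ContinuousOn.intervalIntegrable (continuousOn_const.mul (hcf.mono ?_))
        rw [uIcc_of_le hr.1]
        exact Icc_subset_Icc_right hr.2
      · exact intervalIntegrable_const
    simp only [h1]
    refine (hq.comp hφ.tendsto_atTop).add ?_
    have h3 : Tendsto (fun k => r * (3 * η (φ k))) atTop (𝓝 0) := by
      simpa using ((hη.comp hφ.tendsto_atTop).const_mul 3).const_mul r
    have h4 := tendsto_integral_comp_of_tendsto (H := fun s => 3 * f s) (C := 3 * M)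
      (continuous_const.mul hf) (fun k => (hp (φ k)).continuousOn_val) (fun k r hr => by
        rw [abs_of_nonneg (by linarith [h0 (g (φ k) r)])]
        linarith [hM (g (φ k) r)]) hlim1 hr
    simpa using h4.add h3

namespace IsProfile

variable {h : ℝ → ℝ} {q v ρ : ℝ} {g P : ℝ → ℝ}

theorem hasDerivAt_val (hp : IsProfile h q v ρ g P) {r : ℝ} (h0 : 0 < r) (hr : r < ρ) :
    HasDerivAt g (P r ^ (1 / 3 : ℝ)) r :=
  (hp.deriv_val r ⟨h0.le, hr.le⟩).hasDerivAt (Icc_mem_nhds h0 hr)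

theorem hasDerivAt_slope (hp : IsProfile h q v ρ g P) {r : ℝ} (h0 : 0 < r) (hr : r < ρ) :
    HasDerivAt P (3 * h (g r)) r :=
  (hp.deriv_slope r ⟨h0.le, hr.le⟩).hasDerivAt (Icc_mem_nhds h0 hr)

theorem eventually_hasDerivAt_val (hp : IsProfile h q v ρ g P) {r : ℝ} (h0 : 0 < r)
    (hr : r < ρ) : ∀ᶠ s in 𝓝 r, HasDerivAt g (P s ^ (1 / 3 : ℝ)) s := by
  filter_upwards [Ioo_mem_nhds h0 hr] with s hs using hp.hasDerivAt_val hs.1 hs.2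

theorem hasDerivAt_cbrt_slope (hp : IsProfile h q v ρ g P) {r : ℝ} (h0 : 0 < r) (hr : r < ρ)
    (hP : 0 < P r) :
    HasDerivAt (fun s => P s ^ (1 / 3 : ℝ)) (h (g r) * P r ^ (-(2 / 3) : ℝ)) r := by
  refine ((hp.hasDerivAt_slope h0 hr).rpow_const (p := 1 / 3) (Or.inl hP.ne')).congr_deriv ?_
  rw [show (1 / 3 : ℝ) - 1 = -(2 / 3) by norm_num]
  ring

/-- This is `(g')² g'' = h` for `g' = P^(1/3)` and `g'' = h P^(-2/3)`. -/
theorem cbrt_slope_identity {P h : ℝ} (hP : 0 < P) :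
    (P ^ (1 / 3 : ℝ)) ^ 2 * (h * P ^ (-(2 / 3) : ℝ)) = h := by
  have : (P ^ (1 / 3 : ℝ)) ^ 2 = P ^ (2 / 3 : ℝ) := by
    rw [← Real.rpow_natCast, ← Real.rpow_mul hP.le]; norm_num
  rw [this, mul_left_comm, ← Real.rpow_add hP]
  norm_num

/-- The slope never falls below its initial value. For `q > 0` the radial function thus lies above a
cone at the origin, which is the kink used in the comparison. -/
theorem add_mul_le_val (hp : IsProfile h q v ρ g P) (hq : 0 ≤ q) (h0 : ∀ s, 0 ≤ h s) {r : ℝ}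
    (hr : r ∈ Icc 0 ρ) : v + q ^ (1 / 3 : ℝ) * r ≤ g r := by
  have := monotoneOn_Icc_of_hasDerivWithinAt
    (fun r hr => (hp.deriv_val r hr).sub
      (((hasDerivAt_id r).const_mul (q ^ (1 / 3 : ℝ))).hasDerivWithinAt))
    (fun r hr => sub_nonneg.mpr (by
      simpa using Real.rpow_le_rpow hq (hp.le_slope h0 hr) (by norm_num : (0 : ℝ) ≤ 1 / 3)))
    (left_mem_Icc.mpr (hr.1.trans hr.2)) hr hr.1
  simp only [Pi.sub_apply, id, hp.init_val, mul_zero, sub_zero] at this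
  linarith

end IsProfile

variable {n : ℕ}

theorem exists_norm_eq_one (hn : 0 < n) : ∃ e : E n, ‖e‖ = 1 := by
  have : Nonempty (Fin n) := ⟨⟨0, hn⟩⟩
  exact exists_norm_eq (E n) zero_le_one

/-! ### Comparison by sweeping and the least profile -/

/-- Comparison with a continuous family of strict radial subsolutions. -/
theorem profile_le_super (hn : 0 < n) {f : ℝ → ℝ} {M η q R c D v₀ : ℝ} (h0 : ∀ s, 0 ≤ f s)
    (hM : ∀ s, f s ≤ M) (hη : 0 < η) (hq : 0 < q) (hR : 0 < R) {g P : ℝ → ℝ → ℝ}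
    (hp : ∀ v, IsProfile (fun s => f s + η) q v R (g v) (P v))
    (hD : ∀ v v', ∀ r ∈ Icc 0 R, |g v r - g v' r| ≤ D * |v - v'|)
    (hv₀ : ∀ v < v₀, g v R < c) {w : E n → ℝ}
    (hwc : ContinuousOn w (Metric.closedBall 0 R)) (hwb : ∀ x, ‖x‖ = R → w x = c)
    (hw : IsViscositySuper f (Metric.ball 0 R) w) {x : E n} (hx : x ∈ Metric.closedBall 0 R) :
    g v₀ ‖x‖ ≤ w x := by
  have hk0 : ∀ s, 0 ≤ f s + η := fun s => add_nonneg (h0 s) hη.le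
  have hkM : ∀ s, f s + η ≤ M + η := fun s => by linarith [hM s]
  have hnorm : ∀ x : E n, x ∈ Metric.closedBall 0 R → ‖x‖ ∈ Icc 0 R := fun x hx =>
    ⟨norm_nonneg x, mem_closedBall_zero_iff.mp hx⟩
  have hvcont : ∀ r ∈ Icc 0 R, Continuous fun v => g v r := by
    intro r hr
    refine (LipschitzWith.of_dist_le_mul (K := D.toNNReal) fun v v' => ?_).continuous
    rw [Real.dist_eq, Real.dist_eq]
    exact (hD v v' r hr).trans (mul_le_mul_of_nonneg_right (Real.le_coe_toNNReal D) (abs_nonneg _))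
  suffices hlt : ∀ v₂ < v₀, ∀ x ∈ Metric.closedBall (0 : E n) R, g v₂ ‖x‖ ≤ w x by
    refine le_of_tendsto (((hvcont _ (hnorm x hx)).tendsto v₀).mono_left
      (nhdsWithin_le_nhds (s := Iio v₀))) ?_
    filter_upwards [self_mem_nhdsWithin] with v hv using hlt v hv x hx
  clear hx x
  intro v₂ hv₂ x₂ hx₂
  by_contra! hcon
  have hK : IsCompact (Metric.closedBall (0 : E n) R) := isCompact_closedBall _ _
  obtain ⟨xm, -, hxm⟩ := hK.exists_isMinOn ⟨x₂, hx₂⟩ hwc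
  set T := (q + 3 * (M + η) * R) ^ (1 / 3 : ℝ) with hT
  have hT0 : 0 ≤ T := by
    have : 0 ≤ M := (h0 0).trans (hM 0)
    positivity
  -- A profile rises by at most `T * R`, so starting this far under the minimum of `w` keeps it
  -- strictly below `w`.
  set vm := min v₂ (w xm - T * R - 1) with hvm
  have hstrict : ∀ x ∈ Metric.closedBall (0 : E n) R, g vm ‖x‖ < w x := by
    intro x hx
    have h1 := (hp vm).val_le hq.le hk0 hkM (hnorm x hx)
    have h2 : T * ‖x‖ ≤ T * R := mul_le_mul_of_nonneg_left (hnorm x hx).2 hT0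
    have h3 : vm ≤ w xm - T * R - 1 := min_le_right _ _
    have h4 : w xm ≤ w x := hxm hx
    linarith
  set S : Set (ℝ × E n) := Icc vm v₂ ×ˢ Metric.closedBall (0 : E n) R with hS
  have hScomp : IsCompact S := isCompact_Icc.prod hK
  have hcont : ContinuousOn (fun p : ℝ × E n => g p.1 ‖p.2‖ - w p.2) S := by
    have h1 : ContinuousOn (fun p : ℝ × ℝ => g p.1 p.2) (univ ×ˢ Icc 0 R) := by
      refine continuousOn_prod_of_continuousOn_lipschitzOnWith _ D.toNNReal
        (fun v _ => (hp v).continuousOn_val) fun r hr => ?_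
      refine LipschitzOnWith.of_dist_le_mul fun v _ v' _ => ?_
      rw [Real.dist_eq, Real.dist_eq]
      exact (hD v v' r hr).trans
        (mul_le_mul_of_nonneg_right (Real.le_coe_toNNReal D) (abs_nonneg _))
    refine ContinuousOn.sub (h1.comp (f := fun p : ℝ × E n => (p.1, ‖p.2‖)) (by fun_prop) ?_)
      (hwc.comp continuousOn_snd fun p hp => hp.2)
    exact fun p hp => ⟨trivial, hnorm _ hp.2⟩
  have hS'comp : IsCompact (S ∩ (fun p : ℝ × E n => g p.1 ‖p.2‖ - w p.2) ⁻¹' Ici 0) :=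
    hScomp.of_isClosed_subset
      (hcont.preimage_isClosed_of_isClosed hScomp.isClosed isClosed_Ici) inter_subset_left
  -- `v₁` is the first parameter at which the profile reaches `w`, and `x₁` is a contact point.
  obtain ⟨⟨v₁, x₁⟩, ⟨⟨hv₁, hx₁⟩, h₁⟩, hmin⟩ := hS'comp.exists_isMinOn
    ⟨(v₂, x₂), ⟨⟨right_mem_Icc.mpr (min_le_left _ _), hx₂⟩, by
      simpa using hcon.le⟩⟩ (f := Prod.fst) continuousOn_fst
  simp only [mem_preimage, mem_Ici, sub_nonneg] at h₁ hv₁ hx₁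
  have hvm₁ : vm < v₁ := by
    refine lt_of_le_of_ne hv₁.1 ?_
    rintro rfl
    exact absurd (hstrict x₁ hx₁) (not_lt.mpr h₁)
  have hbelow : ∀ y ∈ Metric.closedBall (0 : E n) R, g v₁ ‖y‖ ≤ w y := by
    intro y hy
    refine le_of_tendsto (((hvcont _ (hnorm y hy)).tendsto v₁).mono_left
      (nhdsWithin_le_nhds (s := Iio v₁))) ?_
    filter_upwards [Ioo_mem_nhdsLT hvm₁] with v hv
    by_contra! hlt
    have : v₁ ≤ v := hmin (a := (v, y)) ⟨⟨⟨hv.1.le, hv.2.le.trans hv₁.2⟩, hy⟩, by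
      simpa using hlt.le⟩
    exact absurd hv.2 (not_lt.mpr this)
  have heq : w x₁ = g v₁ ‖x₁‖ := le_antisymm h₁ (hbelow x₁ hx₁)
  -- Contact on the sphere is excluded, since for `v₁ < v₀` the boundary value is still below `c`.
  have hlt : ‖x₁‖ < R := by
    refine lt_of_le_of_ne (hnorm x₁ hx₁).2 fun hR' => ?_
    have := hv₀ v₁ (hv₁.2.trans_lt hv₂)
    rw [hwb x₁ hR', hR'] at heq
    linarith
  have hball : Metric.ball (0 : E n) R ∈ 𝓝 x₁ :=
    Metric.isOpen_ball.mem_nhds (mem_ball_zero_iff.mpr hlt)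
  rcases eq_or_ne x₁ 0 with rfl | hne
  · obtain ⟨e, he⟩ := exists_norm_eq_one hn
    refine hw.not_kink (mem_ball_zero_iff.mpr hlt) he
      (p := q ^ (1 / 3 : ℝ)) (by positivity) ?_
    filter_upwards [hball] with y hy
    have hy' := Metric.ball_subset_closedBall hy
    have h1 := (hp v₁).add_mul_le_val hq.le hk0 (hnorm y hy')
    have h2 := hbelow y hy'
    rw [heq, norm_zero, (hp v₁).init_val, sub_zero]
    have h3 : |inner ℝ e y| ≤ ‖y‖ := by simpa [he] using abs_real_inner_le_norm e y
    have h4 := mul_le_mul_of_nonneg_left h3 (show 0 ≤ q ^ (1 / 3 : ℝ) by positivity)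
    linarith
  -- Away from the origin, contact would give `f + η ≤ f` at the contact value.
  · have hpos := norm_pos_iff.mpr hne
    have hP : 0 < P v₁ ‖x₁‖ := hq.trans_le ((hp v₁).le_slope hk0 (hnorm x₁ hx₁))
    have := hw.le_of_touching_radial (mem_ball_zero_iff.mpr hlt) hne
      ((hp v₁).eventually_hasDerivAt_val hpos hlt) ((hp v₁).hasDerivAt_cbrt_slope hpos hlt hP)
      (by positivity) heq
      (by filter_upwards [hball] with y hy using hbelow y (Metric.ball_subset_closedBall hy))
    rw [IsProfile.cbrt_slope_identity hP, heq] at this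
    linarith

/-- For every `c` there is a profile with value `c` at `R` lying below all supersolutions with
boundary value `c`. -/
theorem exists_least_profile {f : ℝ → ℝ} {K : NNReal} (hK : LipschitzWith K f)
    {M : ℝ} (h0 : ∀ s, 0 ≤ f s) (hM : ∀ s, f s ≤ M) {R : ℝ} (hR : 0 < R) (c : ℝ) :
    ∃ (v : ℝ) (g P : ℝ → ℝ), IsProfile f 0 v R g P ∧ g R = c ∧
      ∀ {n : ℕ}, 0 < n → ∀ w : E n → ℝ, ContinuousOn w (Metric.closedBall 0 R) →
        (∀ x, ‖x‖ = R → w x = c) → IsViscositySuper f (Metric.ball 0 R) w →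
        ∀ x ∈ Metric.closedBall (0 : E n) R, g ‖x‖ ≤ w x := by
  have hM0 : 0 ≤ M := (h0 0).trans (hM 0)
  have hRmem : R ∈ Icc 0 R := right_mem_Icc.mpr hR.le
  set η : ℕ → ℝ := fun k => 1 / ((k : ℝ) + 1) with hη
  have hη0 : ∀ k, 0 < η k := fun k => by positivity
  have hη1 : ∀ k, η k ≤ 1 := fun k => by
    rw [hη]
    exact (div_le_one (by positivity)).mpr (by linarith [Nat.cast_nonneg (α := ℝ) k])
  have hηlim : Tendsto η atTop (𝓝 0) := tendsto_one_div_add_atTop_nhds_zero_nat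
  have hk0 : ∀ k s, 0 ≤ f s + η k := fun k s => add_nonneg (h0 s) (hη0 k).le
  have hkM : ∀ k s, f s + η k ≤ M + 1 := fun k s => add_le_add (hM s) (hη1 k)
  -- The same `η k` perturbs the equation and serves as `P 0`, the cube of the initial slope.
  choose g P hp D hD using fun k => exists_profile_family (h := fun s => f s + η k) (K := K)
    (LipschitzWith.of_dist_le_mul fun x y => by
      simpa [Real.dist_eq] using hK.dist_le_mul x y) (hk0 k) (hkM k) (hη0 k) hR.le
  set T : ℝ := (1 + 3 * (M + 1) * R) ^ (1 / 3 : ℝ) with hT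
  have hT0 : 0 ≤ T := by positivity
  have hup : ∀ k v, g k v R ≤ v + T * R := by
    intro k v
    refine ((hp k v).val_le (hη0 k).le (hk0 k) (hkM k) hRmem).trans ?_
    have := hη0 k
    have h2 := hη1 k
    rw [hT]
    gcongr
  have hlow : ∀ k v, v ≤ g k v R := fun k v => (hp k v).le_val (hη0 k).le (hk0 k) hRmem
  have hcont : ∀ k, Continuous fun v => g k v R := by
    intro k
    refine (LipschitzWith.of_dist_le_mul (K := (D k).toNNReal) fun v v' => ?_).continuous
    rw [Real.dist_eq, Real.dist_eq]
    exact (hD k v v' R hRmem).trans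
      (mul_le_mul_of_nonneg_right (Real.le_coe_toNNReal _) (abs_nonneg _))
  -- the first parameter at which the family reaches the boundary value
  have hfirst : ∀ k, ∃ v, g k v R = c ∧ (∀ v' < v, g k v' R < c) ∧ |v| ≤ |c| + T * R := by
    intro k
    set A := {v | c ≤ g k v R} with hA
    have hAcl : IsClosed A := isClosed_le continuous_const (hcont k)
    have hAne : A.Nonempty := ⟨c, hlow k c⟩
    have hAbdd : BddBelow A := ⟨c - T * R, fun v hv => by
      have h1 : c ≤ g k v R := hv
      linarith [hup k v]⟩
    have hmem : c ≤ g k (sInf A) R := hAcl.csInf_mem hAne hAbdd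
    have hlt : ∀ v' < sInf A, g k v' R < c := fun v' hv' => by
      by_contra! h
      exact absurd (csInf_le hAbdd (show v' ∈ A from h)) (not_le.mpr hv')
    refine ⟨sInf A, le_antisymm ?_ hmem, hlt, ?_⟩
    · refine le_of_tendsto (((hcont k).tendsto _).mono_left
        (nhdsWithin_le_nhds (s := Iio (sInf A)))) ?_
      filter_upwards [self_mem_nhdsWithin] with v hv using (hlt v hv).le
    -- The bound does not depend on `k`, as the compactness argument requires.
    · have h1 : sInf A ≤ c := csInf_le hAbdd (hlow k c)
      have h2 := hup k (sInf A)
      have h3 : 0 ≤ T * R := by positivity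
      rw [abs_le]
      constructor <;> linarith [le_abs_self c, neg_abs_le c]
  choose v hvR hvlt hvb using hfirst
  obtain ⟨φ, v', g', P', -, hp', hlim⟩ := exists_profile_limit hK.continuous h0 hM hR.le
    (fun k => (hη0 k).le) hη1 (fun k => (hη0 k).le) hη1 hηlim hηlim hvb (fun k => hp k (v k))
  refine ⟨v', g', P', hp', ?_, ?_⟩
  · refine tendsto_nhds_unique (hlim R hRmem) ?_
    simp only [hvR]
    exact tendsto_const_nhds
  · intro n hn w hwc hwb hw x hx
    refine le_of_tendsto (hlim ‖x‖ ⟨norm_nonneg x, mem_closedBall_zero_iff.mp hx⟩) ?_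
    exact Eventually.of_forall fun k =>
      profile_le_super hn h0 hM (hη0 _) (hη0 _) hR (hp _) (hD _) (hvlt _) hwc hwb hw hx

/-- Existence of profiles with vanishing initial slope. -/
theorem exists_profile {f : ℝ → ℝ} {K : NNReal} (hK : LipschitzWith K f) {M : ℝ}
    (h0 : ∀ s, 0 ≤ f s) (hM : ∀ s, f s ≤ M) {R : ℝ} (hR : 0 ≤ R) (b : ℝ) :
    ∃ g P : ℝ → ℝ, IsProfile f 0 b R g P := by
  set η : ℕ → ℝ := fun k => 1 / ((k : ℝ) + 1) with hη
  have hη0 : ∀ k, 0 < η k := fun k => by positivity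
  have hη1 : ∀ k, η k ≤ 1 := fun k => by
    rw [hη]
    exact (div_le_one (by positivity)).mpr (by linarith [Nat.cast_nonneg (α := ℝ) k])
  have hηlim : Tendsto η atTop (𝓝 0) := tendsto_one_div_add_atTop_nhds_zero_nat
  choose g P hp _ using fun k => exists_profile_family (h := f) hK h0 hM (hη0 k) hR
  obtain ⟨φ, v', g', P', -, hp', hlim⟩ := exists_profile_limit (η := fun _ => 0) (v := fun _ => b)
    hK.continuous h0 hM hR (fun k => (hη0 k).le) hη1 (fun _ => le_rfl) (fun _ => zero_le_one)
    hηlim tendsto_const_nhds (fun _ => le_rfl) (fun k => by simpa using hp k b)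
  have hb : v' = b := by
    rw [← hp'.init_val]
    refine tendsto_nhds_unique (hlim 0 (left_mem_Icc.mpr hR)) ?_
    simp only [(hp _ b).init_val]
    exact tendsto_const_nhds
  exact ⟨g', P', hb ▸ hp'⟩

/-! ### Profiles of zero initial slope as viscosity solutions -/

namespace IsProfile

variable {f : ℝ → ℝ} {v R a : ℝ} {g P : ℝ → ℝ}

/-- Where the slope vanishes, so does the right-hand side. -/
theorem eq_zero_of_slope_eq_zero (hp : IsProfile f 0 v R g P) (h0 : ∀ s, 0 ≤ f s) {r : ℝ}
    (hr0 : 0 < r) (hr : r < R) (hP : P r = 0) : f (g r) = 0 := by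
  have hmin : IsLocalMin P r := by
    filter_upwards [Ioo_mem_nhds hr0 hr] with s hs
    rw [hP]
    exact hp.le_slope h0 (Ioo_subset_Icc_self hs)
  have := hmin.hasDerivAt_eq_zero (hp.hasDerivAt_slope hr0 hr)
  linarith

/-- A profile with vanishing initial slope is differentiable at the origin as a function on
`ℝⁿ`. -/
theorem hasFDerivAt_zero {n : ℕ} (hp : IsProfile f 0 v R g P) (hR : 0 < R) :
    HasFDerivAt (fun x : E n => g ‖x‖) (0 : E n →L[ℝ] ℝ) 0 := by
  have h1 := hp.deriv_val 0 (left_mem_Icc.mpr hR.le)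
  rw [hp.init_slope, Real.zero_rpow (by norm_num), hasDerivWithinAt_iff_isLittleO] at h1
  have hT : Tendsto (fun x : E n => ‖x‖) (𝓝 0) (𝓝[Icc 0 R] 0) := by
    refine tendsto_nhdsWithin_iff.mpr ⟨by simpa using continuous_norm.tendsto (0 : E n), ?_⟩
    filter_upwards [Metric.ball_mem_nhds (0 : E n) hR] with x hx
    exact ⟨norm_nonneg x, (mem_ball_zero_iff.mp hx).le⟩
  have h2 := h1.comp_tendsto hT
  rw [hasFDerivAt_iff_isLittleO]
  simp only [Function.comp_def, sub_zero, smul_zero, norm_zero] at h2 ⊢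
  simpa using h2.of_norm_right

/-- A profile with `g'(0) = 0` and `f(g(0)) > 0` has no second order upper bound at the
origin. -/
theorem eventually_sq_le (hp : IsProfile f 0 v R g P) (hf : Continuous f) (hR : 0 < R)
    (hv : 0 < f v) (m : ℝ) : ∃ d > 0, ∀ r ∈ Icc 0 d, v + m * r ^ 2 ≤ g r := by
  have h0 : (0 : ℝ) ∈ Icc 0 R := left_mem_Icc.mpr hR.le
  have h1 : ∀ᶠ r in 𝓝[Icc 0 R] 0, f v / 2 < f (g r) := by
    have : Tendsto (fun r => f (g r)) (𝓝[Icc 0 R] 0) (𝓝 (f (g 0))) :=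
      (hf.tendsto _).comp (hp.continuousOn_val 0 h0)
    rw [hp.init_val] at this
    exact this.eventually (lt_mem_nhds (by linarith))
  obtain ⟨d₁, hd₁, hd₁'⟩ := Metric.mem_nhdsWithin_iff.mp h1
  set κ : ℝ := f v / 2 with hκ
  have hκ0 : 0 < κ := by positivity
  set N : ℝ := |m| + 1 with hN
  have hN0 : 0 < N := by positivity
  -- Near the origin `P ≥ 3κr`, so `g'` is at least of order `r^(1/3)`. The last condition on `d`
  -- ensures `(2Nr)³ ≤ 3κr` on `[0, d]`, so that `g' ≥ 2Nr` there.
  obtain ⟨d, hd0, hdR, hdd₁, hdN⟩ : ∃ d > 0, d ≤ R ∧ d < d₁ ∧ (2 * N) ^ 3 * d ^ 2 ≤ 3 * κ := by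
    have hT : Tendsto (fun d : ℝ => (2 * N) ^ 3 * d ^ 2) (𝓝[>] 0) (𝓝 ((2 * N) ^ 3 * 0 ^ 2)) := by
      have : Continuous fun d : ℝ => (2 * N) ^ 3 * d ^ 2 := by fun_prop
      exact (this.tendsto 0).mono_left nhdsWithin_le_nhds
    have h3 := hT.eventually (gt_mem_nhds (show (2 * N) ^ 3 * 0 ^ 2 < 3 * κ by simp; positivity))
    obtain ⟨d, h4, h5⟩ := (h3.and (Ioo_mem_nhdsGT (lt_min hR hd₁))).exists
    exact ⟨d, h5.1, (h5.2.trans_le (min_le_left _ _)).le, h5.2.trans_le (min_le_right _ _), h4.le⟩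
  have hsub : Icc 0 d ⊆ Icc 0 R := Icc_subset_Icc_right hdR
  have hfk : ∀ r ∈ Icc 0 d, κ ≤ f (g r) := by
    intro r hr
    refine (hd₁' ⟨?_, hsub hr⟩ : κ < f (g r)).le
    rw [mem_ball_zero_iff, Real.norm_of_nonneg hr.1]
    exact hr.2.trans_lt hdd₁
  have hPl : ∀ r ∈ Icc 0 d, 3 * κ * r ≤ P r := by
    intro r hr
    have := monotoneOn_Icc_of_hasDerivWithinAt (ρ := d)
      (fun r hr => ((hp.deriv_slope r (hsub hr)).mono hsub).sub
        (((hasDerivAt_id r).const_mul (3 * κ)).hasDerivWithinAt))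
      (fun r hr => by linarith [hfk r hr])
      (left_mem_Icc.mpr hd0.le) hr hr.1
    simp only [Pi.sub_apply, id, hp.init_slope, mul_zero, sub_zero] at this
    linarith
  have hcb : ∀ r ∈ Icc 0 d, 2 * N * r ≤ P r ^ (1 / 3 : ℝ) := by
    intro r hr
    have h3 : (2 * N * r) ^ 3 ≤ P r := by
      refine le_trans ?_ (hPl r hr)
      have : r ^ 2 ≤ d ^ 2 := by gcongr <;> [exact hr.1; exact hr.2]
      have h4 : (2 * N) ^ 3 * r ^ 2 ≤ 3 * κ :=
        (mul_le_mul_of_nonneg_left this (by positivity)).trans hdN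
      calc (2 * N * r) ^ 3 = (2 * N) ^ 3 * r ^ 2 * r := by ring
        _ ≤ 3 * κ * r := mul_le_mul_of_nonneg_right h4 hr.1
    have h5 : 0 ≤ 2 * N * r := by have := hr.1; positivity
    calc 2 * N * r = ((2 * N * r) ^ 3) ^ (1 / 3 : ℝ) := by
          rw [← Real.rpow_natCast, ← Real.rpow_mul h5]; norm_num
      _ ≤ P r ^ (1 / 3 : ℝ) := Real.rpow_le_rpow (by positivity) h3 (by norm_num)
  refine ⟨d, hd0, fun r hr => ?_⟩
  have := monotoneOn_Icc_of_hasDerivWithinAt (ρ := d)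
    (fun r hr => ((hp.deriv_val r (hsub hr)).mono hsub).sub
      (((hasDerivAt_pow 2 r).const_mul N).hasDerivWithinAt))
    (fun r hr => by have := hcb r hr; simp; linarith)
    (left_mem_Icc.mpr hd0.le) hr hr.1
  simp only [Pi.sub_apply, hp.init_val, ne_eq, OfNat.ofNat_ne_zero, not_false_eq_true, zero_pow,
    mul_zero, sub_zero] at this
  have h6 : m * r ^ 2 ≤ N * r ^ 2 :=
    mul_le_mul_of_nonneg_right ((le_abs_self m).trans (by linarith)) (sq_nonneg r)
  linarith

theorem continuousOn_radial {n : ℕ} (hp : IsProfile f 0 v R g P) :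
    ContinuousOn (fun x : E n => g ‖x‖) (Metric.closedBall 0 R) :=
  hp.continuousOn_val.comp continuous_norm.continuousOn fun x hx =>
    ⟨norm_nonneg x, mem_closedBall_zero_iff.mp hx⟩

/-- Profiles with vanishing initial slope are radial viscosity solutions. -/
theorem isViscositySol {n : ℕ} (hn : 0 < n) (hp : IsProfile f 0 v R g P) (hf : Continuous f)
    (h0 : ∀ s, 0 ≤ f s) (hR : 0 < R) :
    IsViscositySol f (Metric.ball (0 : E n) R) (fun x => g ‖x‖) := by
  have hc : ContinuousOn (fun x : E n => g ‖x‖) (Metric.ball 0 R) :=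
    hp.continuousOn_radial.mono Metric.ball_subset_closedBall
  have hflat : ∀ x : E n, ‖x‖ < R → x ≠ 0 → P ‖x‖ = 0 →
      HasFDerivAt (fun x : E n => g ‖x‖) (0 : E n →L[ℝ] ℝ) x := by
    intro x hxR hx hP
    have h1 := hasFDerivAt_radial hx (hp.hasDerivAt_val (norm_pos_iff.mpr hx) hxR)
    rwa [hP, Real.zero_rpow (by norm_num), zero_smul] at h1
  refine ⟨⟨hc, fun x hx φ hφ hmax => ?_⟩, ⟨hc, fun x hx φ hφ hmin => ?_⟩⟩
  · have hxR : ‖x‖ < R := mem_ball_zero_iff.mp hx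
    rcases eq_or_ne x 0 with rfl | hne
    · rw [infLaplacian_eq_zero_of_isLocalExtr hφ (hp.hasFDerivAt_zero hR) (Or.inr hmax)]
      simp only [norm_zero, hp.init_val]
      -- If `f v > 0`, the profile rises faster than every parabola, so no `C²` function can touch
      -- it from above at the origin.
      by_contra! hv
      obtain ⟨e, he⟩ := exists_norm_eq_one hn
      set m : ℝ := |fderiv ℝ (fderiv ℝ φ) 0 e e| + 1 with hm
      obtain ⟨d, hd, hgd⟩ := hp.eventually_sq_le hf hR hv m
      have h1 : 2 * m ≤ fderiv ℝ (fderiv ℝ φ) 0 e e := by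
        refine le_second_fderiv_of_isLocalMin (k := fun t => m * t ^ 2)
          (k' := fun t => 2 * m * t) hφ ?_ ?_ ?_
        · refine Eventually.of_forall fun t => ?_
          refine ((hasDerivAt_pow 2 t).const_mul m).congr_deriv ?_
          simp; ring
        · simpa using (hasDerivAt_id (0 : ℝ)).const_mul (2 * m)
        · have h2 := isLocalMax_line hmax e
          filter_upwards [h2, Metric.ball_mem_nhds (0 : ℝ) hd] with t ht htd
          have h3 : ‖(0 : E n) + t • e‖ = |t| := by simp [norm_smul, he]
          have h4 := hgd |t| ⟨abs_nonneg t, by simpa using (mem_ball_zero_iff.mp htd).le⟩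
          rw [sq_abs] at h4
          simp only [h3] at ht
          simp only [zero_smul, add_zero, zero_add, norm_zero, hp.init_val] at ht ⊢
          norm_num
          linarith
      have h2 : 0 ≤ |fderiv ℝ (fderiv ℝ φ) 0 e e| := abs_nonneg _
      have h3 := le_abs_self (fderiv ℝ (fderiv ℝ φ) 0 e e)
      linarith
    · have hpos := norm_pos_iff.mpr hne
      rcases (hp.le_slope h0 ⟨hpos.le, hxR.le⟩).eq_or_lt with hP | hP
      -- At a flat point away from the origin `P` has an interior minimum, so `f (g r) = 0` and both
      -- sides vanish.
      · rw [infLaplacian_eq_zero_of_isLocalExtr hφ (hflat x hxR hne hP.symm) (Or.inr hmax)]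
        exact (hp.eq_zero_of_slope_eq_zero h0 hpos hxR hP.symm).le
      · have := radial_le_infLaplacian hne (hp.eventually_hasDerivAt_val hpos hxR)
          (hp.hasDerivAt_cbrt_slope hpos hxR hP) hφ hmax
        rwa [cbrt_slope_identity hP] at this
  · have hxR : ‖x‖ < R := mem_ball_zero_iff.mp hx
    rcases eq_or_ne x 0 with rfl | hne
    · rw [infLaplacian_eq_zero_of_isLocalExtr hφ (hp.hasFDerivAt_zero hR) (Or.inl hmin)]
      exact h0 _
    · have hpos := norm_pos_iff.mpr hne
      rcases (hp.le_slope h0 ⟨hpos.le, hxR.le⟩).eq_or_lt with hP | hP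
      · rw [infLaplacian_eq_zero_of_isLocalExtr hφ (hflat x hxR hne hP.symm) (Or.inl hmin)]
        exact h0 _
      · have := infLaplacian_le_radial hne (hp.eventually_hasDerivAt_val hpos hxR)
          (hp.hasDerivAt_cbrt_slope hpos hxR hP) hφ hmin
        rwa [cbrt_slope_identity hP] at this

/-- A profile reaching values above the zero set `(-∞, a]` of `f` starts above it. -/
theorem le_init (hp : IsProfile f 0 v R g P) (hR : 0 ≤ R) (h0 : ∀ s, 0 ≤ f s)
    (hf0 : ∀ s ≤ a, f s = 0) (ha : a < g R) : a ≤ v := by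
  by_contra! hv
  -- Until the level `a` is reached the right-hand side is zero, hence so is the slope. The profile
  -- is then constant and cannot climb from `v < a` to `a`.
  obtain ⟨r, hr, hgr⟩ : a ∈ g '' Icc 0 R :=
    intermediate_value_Icc hR hp.continuousOn_val ⟨by rw [hp.init_val]; exact hv.le, ha.le⟩
  have hmono := hp.monotoneOn_val le_rfl h0
  have hsub : Icc 0 r ⊆ Icc 0 R := Icc_subset_Icc_right hr.2
  have hf : ∀ s ∈ Icc 0 r, f (g s) = 0 := fun s hs =>
    hf0 _ ((hmono (hsub hs) hr hs.2).trans hgr.le)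
  have hP : ∀ s ∈ Icc 0 r, P s = 0 := by
    intro s hs
    have h1 : P s ≤ 0 := by
      have := monotoneOn_Icc_of_hasDerivWithinAt (ρ := r) (f := fun s => -P s)
        (fun s hs => ((hp.deriv_slope s (hsub hs)).mono hsub).neg)
        (fun s hs => by simp [hf s hs]) (left_mem_Icc.mpr hr.1) hs hs.1
      simp only [hp.init_slope] at this
      linarith
    exact le_antisymm h1 (hp.le_slope h0 (hsub hs))
  have h2 := monotoneOn_Icc_of_hasDerivWithinAt (ρ := r) (f := fun s => -g s)
    (fun s hs => ((hp.deriv_val s (hsub hs)).mono hsub).neg)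
    (fun s hs => by rw [hP s hs, Real.zero_rpow (by norm_num), neg_zero])
    (left_mem_Icc.mpr hr.1) (right_mem_Icc.mpr hr.1) hr.1
  simp only [hp.init_val] at h2
  linarith

end IsProfile

/-! ### The constants and the penalized right-hand side -/

section Constants

variable {γ : ℝ}

theorem one_lt_alpha (h0 : 0 ≤ γ) (h1 : γ < 1) : 1 < alpha γ := by
  rw [alpha, lt_div_iff₀ (by linarith)]
  linarith

theorem alpha_pos (h0 : 0 ≤ γ) : 0 < alpha γ := by
  rw [alpha]; positivity

theorem alpha_mul (h0 : 0 ≤ γ) : alpha γ * (3 + γ) = 4 := by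
  rw [alpha]; field_simp

theorem radialConst_pos (h0 : 0 ≤ γ) (h1 : γ < 1) : 0 < radialConst γ := by
  have := one_lt_alpha h0 h1
  rw [radialConst]
  have : 0 < alpha γ ^ 3 * (alpha γ - 1) := by
    have : 0 < alpha γ - 1 := by linarith
    positivity
  positivity

/-- This is the coefficient identity in `(g')² g'' = g^(-γ)` for `g = C_α r^α`; the powers of `r`
match by `alpha_mul`. -/
theorem radialConst_rpow (h0 : 0 ≤ γ) (h1 : γ < 1) :
    radialConst γ ^ (-γ) = radialConst γ ^ 3 * alpha γ ^ 3 * (alpha γ - 1) := by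
  have hα := one_lt_alpha h0 h1
  have hC := radialConst_pos h0 h1
  have hX : 0 < alpha γ ^ 3 * (alpha γ - 1) := by
    have : 0 < alpha γ - 1 := by linarith
    positivity
  have h2 : radialConst γ ^ (3 + γ) = 1 / (alpha γ ^ 3 * (alpha γ - 1)) := by
    rw [radialConst, ← Real.rpow_mul (by positivity)]
    rw [one_div_mul_cancel (by linarith), Real.rpow_one]
  have h3 : radialConst γ ^ 3 = radialConst γ ^ (3 + γ) * radialConst γ ^ (-γ) := by
    rw [← Real.rpow_add hC, ← Real.rpow_natCast]; norm_num
  rw [h3, h2]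
  field_simp
  rw [div_self (sub_pos.mpr hα).ne']

end Constants

section Penalization

variable {γ δ ε : ℝ} {B : ℝ → ℝ}

theorem div_rpow_alpha_le_iff (hε : 0 < ε) (s d : ℝ) :
    s / ε ^ alpha γ ≤ d ↔ s ≤ d * ε ^ alpha γ := by
  rw [div_le_iff₀ (Real.rpow_pos_of_pos hε _)]

theorem IsCutoff.mem_Icc' (hB : IsCutoff δ B) (s : ℝ) : B s ∈ Icc (0 : ℝ) 1 := by
  rcases le_total 0 s with h | h
  · exact hB.mem_Icc s h
  · rw [hB.eq_zero s (by linarith [hB.delta_pos])]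
    simp

theorem penalizedRHS_eq_zero (hB : IsCutoff δ B) (hε : 0 < ε) {s : ℝ}
    (hs : s ≤ δ / 2 * ε ^ alpha γ) : penalizedRHS γ B ε s = 0 := by
  rw [penalizedRHS, hB.eq_zero _ ((div_rpow_alpha_le_iff hε _ _).mpr hs), zero_mul]

theorem penalizedRHS_eq_rpow (hB : IsCutoff δ B) (hε : 0 < ε) {s : ℝ}
    (hs : δ * ε ^ alpha γ ≤ s) : penalizedRHS γ B ε s = s ^ (-γ) := by
  rw [penalizedRHS, hB.eq_one, one_mul]
  rwa [le_div_iff₀ (Real.rpow_pos_of_pos hε _)]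

theorem penalizedRHS_le_rpow (hB : IsCutoff δ B) {s : ℝ} (hs : 0 < s) :
    penalizedRHS γ B ε s ≤ s ^ (-γ) :=
  mul_le_of_le_one_left (Real.rpow_nonneg hs.le _) (hB.mem_Icc' _).2

/-- Below the threshold the cut-off vanishes, so the argument of the power may be kept away from its
singularity. Nonnegativity, boundedness and the Lipschitz property are read off from this form. -/
theorem penalizedRHS_eq_max (hB : IsCutoff δ B) (hε : 0 < ε) (s : ℝ) :
    penalizedRHS γ B ε s = B (s / ε ^ alpha γ) * max (δ / 2 * ε ^ alpha γ) s ^ (-γ) := by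
  rcases le_total s (δ / 2 * ε ^ alpha γ) with h | h
  · rw [penalizedRHS_eq_zero hB hε h, hB.eq_zero _ ((div_rpow_alpha_le_iff hε _ _).mpr h), zero_mul]
  · rw [max_eq_right h, penalizedRHS]

theorem threshold_pos (hB : IsCutoff δ B) (hε : 0 < ε) : 0 < δ / 2 * ε ^ alpha γ := by
  have := hB.delta_pos
  positivity

theorem penalizedRHS_nonneg (hB : IsCutoff δ B) (hε : 0 < ε) (s : ℝ) :
    0 ≤ penalizedRHS γ B ε s := by
  rw [penalizedRHS_eq_max hB hε]
  exact mul_nonneg (hB.mem_Icc' _).1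
    (Real.rpow_nonneg ((threshold_pos hB hε).le.trans (le_max_left _ _)) _)

theorem max_rpow_le (hγ : 0 ≤ γ) {a : ℝ} (ha : 0 < a) (s : ℝ) :
    max a s ^ (-γ) ≤ a ^ (-γ) :=
  Real.rpow_le_rpow_of_nonpos ha (le_max_left _ _) (by linarith)

theorem penalizedRHS_le (hγ : 0 ≤ γ) (hB : IsCutoff δ B) (hε : 0 < ε) (s : ℝ) :
    penalizedRHS γ B ε s ≤ (δ / 2 * ε ^ alpha γ) ^ (-γ) := by
  have ha := threshold_pos (γ := γ) hB hε
  rw [penalizedRHS_eq_max hB hε]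
  refine (mul_le_of_le_one_left ?_ (hB.mem_Icc' _).2).trans (max_rpow_le hγ ha s)
  exact Real.rpow_nonneg (ha.le.trans (le_max_left _ _)) _

theorem penalizedRHS_lipschitz (hγ : 0 ≤ γ) (hB : IsCutoff δ B) (hε : 0 < ε) :
    ∃ K : NNReal, LipschitzWith K (penalizedRHS γ B ε) := by
  obtain ⟨K, hK⟩ := hB.lipschitz
  set a := δ / 2 * ε ^ alpha γ with ha
  have ha0 : 0 < a := threshold_pos hB hε
  have hεα : 0 < ε ^ alpha γ := Real.rpow_pos_of_pos hε _
  have hpow : ∀ s t : ℝ, |max a s ^ (-γ) - max a t ^ (-γ)| ≤ γ * a ^ (-γ - 1) * |s - t| := by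
    intro s t
    have h1 : |max a s ^ (-γ) - max a t ^ (-γ)|
        ≤ γ * a ^ (-γ - 1) * |max a s - max a t| := by
      refine Convex.norm_image_sub_le_of_norm_hasDerivWithin_le (f := fun x : ℝ => x ^ (-γ))
        (f' := fun x => -γ * x ^ (-γ - 1)) (s := Ici a) ?_ ?_ (convex_Ici a)
        (mem_Ici.mpr (le_max_left _ _)) (mem_Ici.mpr (le_max_left _ _))
      · intro z hz
        exact (Real.hasDerivAt_rpow_const (Or.inl (ha0.trans_le hz).ne')).hasDerivWithinAt
      · intro z hz
        have hz0 : 0 < z := ha0.trans_le hz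
        rw [norm_mul, norm_neg, Real.norm_of_nonneg hγ, Real.norm_of_nonneg (by positivity)]
        exact mul_le_mul_of_nonneg_left
          (Real.rpow_le_rpow_of_nonpos ha0 hz (by linarith)) hγ
    refine h1.trans (mul_le_mul_of_nonneg_left ?_ (by positivity))
    refine (abs_max_sub_max_le_max _ _ _ _).trans ?_
    rw [sub_self, abs_zero, max_eq_right (abs_nonneg _)]
  have hcut : ∀ s t : ℝ, |B (s / ε ^ alpha γ) - B (t / ε ^ alpha γ)|
      ≤ K / ε ^ alpha γ * |s - t| := by
    intro s t
    have := hK.dist_le_mul (s / ε ^ alpha γ) (t / ε ^ alpha γ)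
    rw [Real.dist_eq, Real.dist_eq, ← sub_div, abs_div, abs_of_pos hεα] at this
    refine this.trans (le_of_eq ?_)
    field_simp
  refine ⟨(γ * a ^ (-γ - 1) + a ^ (-γ) * (K / ε ^ alpha γ)).toNNReal,
    LipschitzWith.of_dist_le_mul fun s t => ?_⟩
  rw [Real.coe_toNNReal _ (by positivity), Real.dist_eq, Real.dist_eq,
    penalizedRHS_eq_max hB hε, penalizedRHS_eq_max hB hε, ← ha]
  have hsplit : B (s / ε ^ alpha γ) * max a s ^ (-γ) - B (t / ε ^ alpha γ) * max a t ^ (-γ)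
      = B (s / ε ^ alpha γ) * (max a s ^ (-γ) - max a t ^ (-γ))
        + max a t ^ (-γ) * (B (s / ε ^ alpha γ) - B (t / ε ^ alpha γ)) := by ring
  rw [hsplit, add_mul]
  refine (abs_add_le _ _).trans (add_le_add ?_ ?_)
  · rw [abs_mul, abs_of_nonneg (hB.mem_Icc' _).1]
    exact (mul_le_of_le_one_left (abs_nonneg _) (hB.mem_Icc' _).2).trans (hpow s t)
  · rw [abs_mul, abs_of_nonneg (Real.rpow_nonneg (ha0.le.trans (le_max_left _ _)) _), mul_assoc]
    exact mul_le_mul (max_rpow_le hγ ha0 t) (hcut s t) (abs_nonneg _) (by positivity)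

end Penalization

/-! ### Energy estimate and bounds in the radius variable -/

/-- The inverse of `r ↦ C_α r ^ α`. -/
noncomputable def radius (γ s : ℝ) : ℝ := (s / radialConst γ) ^ (1 / alpha γ)

section Radius

variable {γ : ℝ}

theorem radialConst_mul_radius (h0 : 0 ≤ γ) (h1 : γ < 1) {s : ℝ} (hs : 0 ≤ s) :
    radialConst γ * radius γ s ^ alpha γ = s := by
  have hC := radialConst_pos h0 h1
  have hα := alpha_pos h0
  rw [radius, ← Real.rpow_mul (by positivity), one_div_mul_cancel hα.ne', Real.rpow_one]
  field_simp

theorem radius_radialConst_mul (h0 : 0 ≤ γ) (h1 : γ < 1) {r : ℝ} (hr : 0 ≤ r) :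
    radius γ (radialConst γ * r ^ alpha γ) = r := by
  have hC := radialConst_pos h0 h1
  have hα := alpha_pos h0
  rw [radius, mul_div_cancel_left₀ _ hC.ne', ← Real.rpow_mul hr, mul_one_div_cancel hα.ne',
    Real.rpow_one]

theorem radius_nonneg (h0 : 0 ≤ γ) (h1 : γ < 1) {s : ℝ} (hs : 0 ≤ s) : 0 ≤ radius γ s := by
  have hC := radialConst_pos h0 h1
  rw [radius]; positivity

theorem radius_pos (h0 : 0 ≤ γ) (h1 : γ < 1) {s : ℝ} (hs : 0 < s) : 0 < radius γ s := by
  have hC := radialConst_pos h0 h1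
  rw [radius]; positivity

theorem continuous_radius (h0 : 0 ≤ γ) : Continuous (radius γ) :=
  (Real.continuous_rpow_const (one_div_pos.mpr (alpha_pos h0)).le).comp (continuous_id.div_const _)

end Radius

namespace IsProfile

variable {γ v R : ℝ} {f g P : ℝ → ℝ}

/-- The energy estimate. -/
theorem energy_le (hp : IsProfile f 0 v R g P) (h1 : γ < 1) (hf0 : ∀ s, 0 ≤ f s)
    (hfγ : ∀ s, 0 < s → f s ≤ s ^ (-γ)) (hv : 0 < v) {r : ℝ} (hr : r ∈ Icc 0 R) :
    P r ^ (4 / 3 : ℝ) ≤ 4 / (1 - γ) * g r ^ (1 - γ) := by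
  have hg : ∀ r ∈ Icc 0 R, 0 < g r := fun r hr => hv.trans_le (hp.le_val le_rfl hf0 hr)
  have hP : ∀ r ∈ Icc 0 R, 0 ≤ P r := fun r hr => hp.le_slope hf0 hr
  have h1γ : 0 < 1 - γ := by linarith
  -- Since `P^(4/3) = (g')⁴`, its derivative is `4 g' f(g)`, at most `4 g' g^(-γ)`, the derivative
  -- of `4/(1-γ) g^(1-γ)`.
  have := monotoneOn_Icc_of_hasDerivWithinAt
    (f := fun r => 4 / (1 - γ) * g r ^ (1 - γ) - P r ^ (4 / 3 : ℝ))
    (f' := fun r => 4 * P r ^ (1 / 3 : ℝ) * (g r ^ (-γ) - f (g r)))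
    (fun r hr => by
      have h2 := ((hp.deriv_val r hr).rpow_const (p := 1 - γ)
        (Or.inl (hg r hr).ne')).const_mul (4 / (1 - γ))
      have h3 := (hp.deriv_slope r hr).rpow_const (p := 4 / 3) (Or.inr (by norm_num))
      refine (h2.sub h3).congr_deriv ?_
      rw [show (1 - γ) - 1 = -γ by ring, show (4 / 3 : ℝ) - 1 = 1 / 3 by norm_num]
      field_simp)
    (fun r hr => by
      have h2 := Real.rpow_nonneg (hP r hr) (1 / 3)
      have h3 := hfγ _ (hg r hr)
      exact mul_nonneg (by positivity) (sub_nonneg.mpr h3))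
    (left_mem_Icc.mpr (hr.1.trans hr.2)) hr hr.1
  simp only [hp.init_slope, hp.init_val] at this
  rw [Real.zero_rpow (by norm_num)] at this
  have h2 : 0 ≤ 4 / (1 - γ) * v ^ (1 - γ) := by positivity
  linarith

/-- The energy bound with `g = C_α z^α` substituted. Fourth powers turn it into the stated form
exactly, because `4(α - 1) = α(1 - γ)`; the right-hand side is the slope of `C_α z^α`. -/
theorem cbrt_slope_le_radius (hp : IsProfile f 0 v R g P) (h0 : 0 ≤ γ) (h1 : γ < 1)
    (hf0 : ∀ s, 0 ≤ f s) (hfγ : ∀ s, 0 < s → f s ≤ s ^ (-γ)) (hv : 0 < v) {r : ℝ}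
    (hr : r ∈ Icc 0 R) :
    P r ^ (1 / 3 : ℝ) ≤ alpha γ * radialConst γ * radius γ (g r) ^ (alpha γ - 1) := by
  have hg : 0 < g r := hv.trans_le (hp.le_val le_rfl hf0 hr)
  have hP : 0 ≤ P r := hp.le_slope hf0 hr
  have hC := radialConst_pos h0 h1
  have hα := one_lt_alpha h0 h1
  have hα0 := alpha_pos h0
  have hz := radius_pos h0 h1 hg
  have h1γ : 0 < 1 - γ := by linarith
  have hen := hp.energy_le h1 hf0 hfγ hv hr
  have hαγ : alpha γ * (1 - γ) = 4 * (alpha γ - 1) := by linarith [alpha_mul h0]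
  refine le_of_pow_le_pow_left₀ (n := 4) (by norm_num) (by positivity) ?_
  have h2 : (P r ^ (1 / 3 : ℝ)) ^ 4 = P r ^ (4 / 3 : ℝ) := by
    rw [← Real.rpow_natCast, ← Real.rpow_mul hP]; norm_num
  rw [h2]
  refine hen.trans (le_of_eq ?_)
  rw [mul_pow, mul_pow]
  have h3 : (radius γ (g r) ^ (alpha γ - 1)) ^ 4 = radius γ (g r) ^ (alpha γ * (1 - γ)) := by
    rw [← Real.rpow_natCast, ← Real.rpow_mul hz.le, hαγ]
    congr 1
    push_cast; ring
  have h4 : g r ^ (1 - γ) = radialConst γ ^ (1 - γ) * radius γ (g r) ^ (alpha γ * (1 - γ)) := by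
    conv_lhs => rw [← radialConst_mul_radius h0 h1 hg.le]
    rw [Real.mul_rpow hC.le (by positivity), ← Real.rpow_mul hz.le]
  have h5 : radialConst γ ^ (1 - γ) = radialConst γ * radialConst γ ^ (-γ) := by
    rw [sub_eq_add_neg, Real.rpow_add hC, Real.rpow_one]
  rw [h3, h4, h5, radialConst_rpow h0 h1, show alpha γ - 1 = alpha γ * (1 - γ) / 4 by linarith]
  field_simp

/-- In terms of the radius variable a profile grows at most at unit speed. -/
theorem radius_sub_le (hp : IsProfile f 0 v R g P) (h0 : 0 ≤ γ) (h1 : γ < 1)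
    (hf0 : ∀ s, 0 ≤ f s) (hfγ : ∀ s, 0 < s → f s ≤ s ^ (-γ)) (hv : 0 < v) {r s : ℝ}
    (hr : r ∈ Icc 0 R) (hs : s ∈ Icc 0 R) (hrs : r ≤ s) :
    radius γ (g s) - radius γ (g r) ≤ s - r := by
  have hg : ∀ r ∈ Icc 0 R, 0 < g r := fun r hr => hv.trans_le (hp.le_val le_rfl hf0 hr)
  have hC := radialConst_pos h0 h1
  have hα0 := alpha_pos h0
  have := monotoneOn_Icc_of_hasDerivWithinAt (f := fun r => r - radius γ (g r))
    (f' := fun r => 1 - P r ^ (1 / 3 : ℝ) / radialConst γ * (1 / alpha γ) *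
      (g r / radialConst γ) ^ (1 / alpha γ - 1))
    (fun r hr => by
      have h2 := ((hp.deriv_val r hr).div_const (radialConst γ)).rpow_const (p := 1 / alpha γ)
        (Or.inl (div_pos (hg r hr) hC).ne')
      exact (hasDerivWithinAt_id r _).sub h2)
    (fun r hr => by
      have hz := radius_pos h0 h1 (hg r hr)
      have h2 := hp.cbrt_slope_le_radius h0 h1 hf0 hfγ hv hr
      have h3 : (g r / radialConst γ) ^ (1 / alpha γ - 1)
          = (radius γ (g r) ^ (alpha γ - 1))⁻¹ := by
        have h6 := hg r hr
        rw [radius, ← Real.rpow_neg (by positivity), ← Real.rpow_mul (by positivity)]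
        congr 1
        field_simp
        ring
      have h4 : 0 < radius γ (g r) ^ (alpha γ - 1) := Real.rpow_pos_of_pos hz _
      rw [h3, sub_nonneg, mul_inv_le_iff₀ h4, one_mul, div_mul_div_comm, mul_one,
        div_le_iff₀ (by positivity)]
      linarith) hr hs hrs
  simp only at this
  linarith

theorem val_le_of_radius (hp : IsProfile f 0 v R g P) (h0 : 0 ≤ γ) (h1 : γ < 1)
    (hf0 : ∀ s, 0 ≤ f s) (hfγ : ∀ s, 0 < s → f s ≤ s ^ (-γ)) (hv : 0 < v) {r : ℝ}
    (hr : r ∈ Icc 0 R) : g r ≤ radialConst γ * (r + radius γ v) ^ alpha γ := by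
  have hg : 0 < g r := hv.trans_le (hp.le_val le_rfl hf0 hr)
  have hC := radialConst_pos h0 h1
  have h2 := hp.radius_sub_le h0 h1 hf0 hfγ hv (left_mem_Icc.mpr (hr.1.trans hr.2)) hr hr.1
  rw [hp.init_val] at h2
  have hz := radius_pos h0 h1 hg
  have hα0 := alpha_pos h0
  calc g r = radialConst γ * radius γ (g r) ^ alpha γ :=
        (radialConst_mul_radius h0 h1 hg.le).symm
    _ ≤ _ := by
        gcongr
        linarith

/-- Because `s^(-γ)` is nonincreasing, the upper bound on `g` bounds `P'` from below, and two
integrations follow. The subtracted linear term accounts for the zero initial slope, where the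
shifted power has a positive one; it vanishes as the shift tends to zero. -/
theorem le_val_of_radius (hp : IsProfile f 0 v R g P) (h0 : 0 ≤ γ) (h1 : γ < 1)
    (hf0 : ∀ s, 0 ≤ f s) (hfγ : ∀ s, 0 < s → f s ≤ s ^ (-γ)) (hv : 0 < v)
    (hfv : ∀ s, v ≤ s → f s = s ^ (-γ)) {r : ℝ} (hr : r ∈ Icc 0 R) :
    radialConst γ * ((r + radius γ v) ^ alpha γ - alpha γ * radius γ v ^ (alpha γ - 1) * r)
      ≤ g r := by
  set h := radius γ v with hh
  have hh0 : 0 < h := radius_pos h0 h1 hv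
  have hC := radialConst_pos h0 h1
  have hα := one_lt_alpha h0 h1
  have hα0 := alpha_pos h0
  set α := alpha γ with hαdef
  set C := radialConst γ with hCdef
  have hg : ∀ r ∈ Icc 0 R, v ≤ g r := fun r hr => hp.le_val le_rfl hf0 hr
  have hαγ : -γ * α = 3 * (α - 1) - 1 := by linarith [alpha_mul h0]
  have hP : ∀ r ∈ Icc 0 R,
      C ^ 3 * α ^ 3 * ((r + h) ^ (3 * (α - 1)) - h ^ (3 * (α - 1))) ≤ P r := by
    intro r hr
    have := monotoneOn_Icc_of_hasDerivWithinAt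
      (f := fun r => P r - C ^ 3 * α ^ 3 * (r + h) ^ (3 * (α - 1)))
      (f' := fun r => 3 * f (g r) - C ^ 3 * α ^ 3 *
        (1 * (3 * (α - 1)) * (r + h) ^ (3 * (α - 1) - 1)))
      (fun r hr => by
        have hrh : 0 < r + h := add_pos_of_nonneg_of_pos hr.1 hh0
        exact (hp.deriv_slope r hr).sub ((((hasDerivAt_id r).add_const h).rpow_const
          (Or.inl hrh.ne')).const_mul _).hasDerivWithinAt)
      (fun r hr => by
        have hrh : 0 < r + h := add_pos_of_nonneg_of_pos hr.1 hh0
        rw [hfv _ (hg r hr), ← hαγ]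
        have h2 : (C * (r + h) ^ α) ^ (-γ) ≤ g r ^ (-γ) :=
          Real.rpow_le_rpow_of_nonpos (hv.trans_le (hg r hr))
            (hp.val_le_of_radius h0 h1 hf0 hfγ hv hr) (by linarith)
        rw [Real.mul_rpow hC.le (by positivity), ← Real.rpow_mul hrh.le,
          radialConst_rpow h0 h1, mul_comm α] at h2
        linarith)
      (left_mem_Icc.mpr (hr.1.trans hr.2)) hr hr.1
    simp only [hp.init_slope, zero_add] at this
    linarith
  have hcb : ∀ r ∈ Icc 0 R, C * α * ((r + h) ^ (α - 1) - h ^ (α - 1)) ≤ P r ^ (1 / 3 : ℝ) := by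
    intro r hr
    have hrh : h ≤ r + h := by linarith [hr.1]
    set x := (r + h) ^ (α - 1) with hx
    set y := h ^ (α - 1) with hy
    have hy0 : 0 ≤ y := by positivity
    have hyx : y ≤ x := Real.rpow_le_rpow hh0.le hrh (by linarith)
    have h3 : (C * α * (x - y)) ^ 3 ≤ P r := by
      refine le_trans ?_ (hP r hr)
      rw [mul_comm 3 (α - 1), Real.rpow_mul (by linarith), Real.rpow_mul hh0.le]
      -- Superadditivity of the cube on nonnegative numbers allows the cube root to be taken of a
      -- difference.
      have h4 : (x - y) ^ 3 ≤ x ^ 3 - y ^ 3 := by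
        nlinarith [mul_nonneg (mul_nonneg hy0 (hy0.trans hyx)) (sub_nonneg.mpr hyx)]
      have h5 : (C * α * (x - y)) ^ 3 = C ^ 3 * α ^ 3 * (x - y) ^ 3 := by ring
      rw [h5]
      refine mul_le_mul_of_nonneg_left ?_ (by positivity)
      exact_mod_cast h4
    have h6 : 0 ≤ C * α * (x - y) := mul_nonneg (by positivity) (sub_nonneg.mpr hyx)
    calc C * α * (x - y) = ((C * α * (x - y)) ^ 3) ^ (1 / 3 : ℝ) := by
          rw [← Real.rpow_natCast, ← Real.rpow_mul h6]; norm_num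
      _ ≤ P r ^ (1 / 3 : ℝ) := Real.rpow_le_rpow (by positivity) h3 (by norm_num)
  have := monotoneOn_Icc_of_hasDerivWithinAt
    (f := fun r => g r - C * ((r + h) ^ α - α * h ^ (α - 1) * r))
    (f' := fun r => P r ^ (1 / 3 : ℝ) -
      C * (1 * α * (r + h) ^ (α - 1) - α * h ^ (α - 1) * 1))
    (fun r hr => by
      have hrh : 0 < r + h := add_pos_of_nonneg_of_pos hr.1 hh0
      exact (hp.deriv_val r hr).sub (((((hasDerivAt_id r).add_const h).rpow_const
        (Or.inl hrh.ne')).sub ((hasDerivAt_id r).const_mul _)).const_mul C).hasDerivWithinAt)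
    (fun r hr => by
      have := hcb r hr
      linarith)
    (left_mem_Icc.mpr (hr.1.trans hr.2)) hr hr.1
  simp only [hp.init_val, zero_add, mul_zero, sub_zero] at this
  rw [radialConst_mul_radius h0 h1 hv.le, sub_self] at this
  linarith

end IsProfile

/-! ### Radial minimal solutions and uniform convergence -/

/-- Radial minimal solutions of the penalized problem, with two-sided bounds. -/
theorem exists_minimal_radial {n : ℕ} (hn : 0 < n) {γ δ ε R : ℝ} {B : ℝ → ℝ} (h0 : 0 ≤ γ)
    (h1 : γ < 1) (hB : IsCutoff δ B) (hε : 0 < ε) (hR : 0 < R) :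
    ∃ (c : ℝ) (g : ℝ → ℝ), 0 < c ∧
      IsMinimalSol γ B ε (Metric.ball (0 : E n) R) (fun _ => c) (fun x => g ‖x‖) ∧
      radialConst γ * ((R + radius γ (δ * ε ^ alpha γ)) ^ alpha γ
        - alpha γ * radius γ (δ * ε ^ alpha γ) ^ (alpha γ - 1) * R) ≤ c ∧
      c ≤ radialConst γ * (R + radius γ (δ * ε ^ alpha γ)) ^ alpha γ ∧
      ∀ r ∈ Icc 0 R,
        radialConst γ * max (r + (radius γ c - R)) 0 ^ alpha γ ≤ g r ∧
        g r ≤ radialConst γ * (r + radius γ (δ * ε ^ alpha γ)) ^ alpha γ := by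
  obtain ⟨K, hK⟩ := penalizedRHS_lipschitz (γ := γ) h0 hB hε
  have hf0 := penalizedRHS_nonneg (γ := γ) hB hε
  have hfM := penalizedRHS_le (γ := γ) h0 hB hε
  have hfγ : ∀ s, 0 < s → penalizedRHS γ B ε s ≤ s ^ (-γ) := fun s hs =>
    penalizedRHS_le_rpow hB hs
  set b := δ * ε ^ alpha γ with hb
  have ha := threshold_pos (γ := γ) hB hε
  have hb0 : 0 < b := by rw [hb]; linarith
  have hRmem : R ∈ Icc 0 R := right_mem_Icc.mpr hR.le
  -- Starting at `b`, where the cut-off has become one, `W` sees only the pure power. Its end value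
  -- serves as the boundary datum; the least profile `g` with that datum may differ from `W`.
  obtain ⟨W, Q, hW⟩ := exists_profile hK hf0 hfM hR.le b
  obtain ⟨v, g, P, hp, hgR, hleast⟩ := exists_least_profile hK hf0 hfM hR (W R)
  have hWR : b ≤ W R := hW.le_val le_rfl hf0 hRmem
  have hC := radialConst_pos h0 h1
  have hα0 := alpha_pos h0
  have hclos : closure (Metric.ball (0 : E n) R) = Metric.closedBall 0 R := closure_ball _ hR.ne'
  have hfron : frontier (Metric.ball (0 : E n) R) = Metric.sphere 0 R := frontier_ball _ hR.ne'
  have hv : δ / 2 * ε ^ alpha γ ≤ v := hp.le_init hR.le hf0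
    (fun s hs => penalizedRHS_eq_zero hB hε hs) (by rw [hgR]; linarith)
  have hv0 : 0 < v := ha.trans_le hv
  refine ⟨W R, g, hb0.trans_le hWR, ⟨?_, ?_, ?_, ?_, ?_⟩, ?_, ?_, ?_⟩
  · rw [hclos]; exact hp.continuousOn_radial
  · intro x hx
    rw [hfron, mem_sphere_zero_iff_norm] at hx
    simp only [hx, hgR]
  · exact hp.isViscositySol hn hK.continuous hf0 hR
  · intro x hx
    rw [hclos, mem_closedBall_zero_iff] at hx
    exact hv0.le.trans (hp.le_val le_rfl hf0 ⟨norm_nonneg x, hx⟩)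
  · intro w hw x hx
    rw [hclos] at hx
    refine hleast hn w (hclos ▸ hw.continuousOn) (fun y hy => ?_) hw.super x hx
    exact hw.boundary (by rw [hfron, mem_sphere_zero_iff_norm]; exact hy)
  · exact hW.le_val_of_radius h0 h1 hf0 hfγ hb0 (fun s hs => penalizedRHS_eq_rpow hB hε hs) hRmem
  · exact hW.val_le_of_radius h0 h1 hf0 hfγ hb0 hRmem
  · intro r hr
    have hgr : 0 < g r := hv0.trans_le (hp.le_val le_rfl hf0 hr)
    constructor
    -- Unit speed is used backwards from `R`, where the value is known, so no information on `v`
    -- beyond positivity is needed.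
    · have h2 := hp.radius_sub_le h0 h1 hf0 hfγ hv0 hr hRmem hr.2
      rw [hgR] at h2
      have hz := radius_pos h0 h1 hgr
      calc radialConst γ * max (r + (radius γ (W R) - R)) 0 ^ alpha γ
          ≤ radialConst γ * radius γ (g r) ^ alpha γ := by
            gcongr
            exact max_le (by linarith) hz.le
        _ = g r := radialConst_mul_radius h0 h1 hgr.le
    -- `W` is itself a supersolution with the same boundary value, so minimality gives `g ≤ W`.
    · refine le_trans ?_ (hW.val_le_of_radius h0 h1 hf0 hfγ hb0 hr)
      obtain ⟨e, he⟩ := exists_norm_eq_one hn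
      have hre : ‖r • e‖ = r := by rw [norm_smul, he, mul_one, Real.norm_of_nonneg hr.1]
      have h2 := hleast hn (fun x : E n => W ‖x‖) hW.continuousOn_radial
        (fun y hy => by simp only [hy]) (hW.isViscositySol hn hK.continuous hf0 hR).2
        (r • e) (by rw [mem_closedBall_zero_iff, hre]; exact hr.2)
      simpa only [hre] using h2

theorem tendstoUniformlyOn_radial_shift {n : ℕ} {Θ : ℝ → ℝ} (hΘ : Continuous Θ) {l : Filter ℝ}
    {e : ℝ → ℝ} (he : Tendsto e l (𝓝 0)) (R : ℝ) :
    TendstoUniformlyOn (fun ε (x : E n) => Θ (‖x‖ + e ε)) (fun x => Θ ‖x‖) l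
      (Metric.closedBall 0 R) := by
  rw [Metric.tendstoUniformlyOn_iff]
  intro η hη
  -- The margin of one on each side accommodates shifts of either sign.
  have huc := (isCompact_Icc (a := (-1 : ℝ)) (b := R + 1)).uniformContinuousOn_of_continuous
    hΘ.continuousOn
  obtain ⟨d, hd, hd'⟩ := Metric.uniformContinuousOn_iff.mp huc η hη
  have h1 : ∀ᶠ ε in l, |e ε| < min d 1 := by
    have := he.eventually (Metric.ball_mem_nhds (0 : ℝ) (lt_min hd one_pos))
    simpa using this
  filter_upwards [h1] with ε hε x hx
  have hx0 := norm_nonneg x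
  have hxR := mem_closedBall_zero_iff.mp hx
  have h2 := abs_lt.mp (hε.trans_le (min_le_right _ _))
  refine hd' _ ⟨by linarith, by linarith⟩ _ ⟨by linarith, by linarith⟩ ?_
  rw [Real.dist_eq, show ‖x‖ - (‖x‖ + e ε) = -e ε by ring, abs_neg]
  exact hε.trans_le (min_le_left _ _)

theorem tendstoUniformlyOn_squeeze {X : Type*} {l : Filter ℝ} {S : Set X} {F G H : ℝ → X → ℝ}
    {u : X → ℝ} (hF : TendstoUniformlyOn F u l S) (hH : TendstoUniformlyOn H u l S)
    (hFG : ∀ᶠ ε in l, ∀ x ∈ S, F ε x ≤ G ε x) (hGH : ∀ᶠ ε in l, ∀ x ∈ S, G ε x ≤ H ε x) :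
    TendstoUniformlyOn G u l S := by
  rw [Metric.tendstoUniformlyOn_iff] at *
  intro η hη
  filter_upwards [hF η hη, hH η hη, hFG, hGH] with ε h1 h2 h3 h4 x hx
  have h5 := abs_lt.mp (h1 x hx)
  have h6 := abs_lt.mp (h2 x hx)
  rw [Real.dist_eq, abs_lt]
  constructor <;> linarith [h3 x hx, h4 x hx]

/-! ### The explicit profiles, the free boundary and optimal regularity -/

section Explicit

variable {γ : ℝ}

/-- The continuous profile `t ↦ C_α (t⁺) ^ α`. -/
noncomputable def powerProfile (γ t : ℝ) : ℝ := radialConst γ * max t 0 ^ alpha γ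

theorem continuous_powerProfile (h0 : 0 ≤ γ) : Continuous (powerProfile γ) :=
  continuous_const.mul ((Real.continuous_rpow_const (alpha_pos h0).le).comp
    (continuous_id.max continuous_const))

theorem powerProfile_of_nonneg {t : ℝ} (ht : 0 ≤ t) :
    powerProfile γ t = radialConst γ * t ^ alpha γ := by
  rw [powerProfile, max_eq_left ht]

theorem powerProfile_norm {n : ℕ} :
    (fun x : E n => powerProfile γ ‖x‖) = omega γ := by
  ext x; rw [powerProfile_of_nonneg (norm_nonneg x), omega]

theorem continuous_omega {n : ℕ} (h0 : 0 ≤ γ) : Continuous (omega γ : E n → ℝ) := by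
  rw [← powerProfile_norm]
  exact (continuous_powerProfile h0).comp continuous_norm

theorem tendsto_nhdsGT_zero_id : Tendsto (fun ε : ℝ => ε) (𝓝[>] 0) (𝓝 0) :=
  tendsto_id.mono_left nhdsWithin_le_nhds

theorem tendstoUniformlyOn_omegaShift {n : ℕ} (h0 : 0 ≤ γ) (R : ℝ) :
    TendstoUniformlyOn (fun ε => omegaShift (n := n) γ ε) (omega γ) (𝓝[>] 0)
      (Metric.closedBall 0 R) := by
  have := tendstoUniformlyOn_radial_shift (n := n) (continuous_powerProfile h0)
    tendsto_nhdsGT_zero_id R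
  rw [powerProfile_norm] at this
  refine this.congr ?_
  filter_upwards [self_mem_nhdsWithin] with ε hε x _
  exact powerProfile_of_nonneg (add_nonneg (norm_nonneg x) (le_of_lt hε))

/-- A shift of the radius leaves the profile equation unchanged. The case `ε = 0` is included so
that `ω` is covered as well. -/
theorem isViscositySol_shift {n : ℕ} (h0 : 0 ≤ γ) (h1 : γ < 1) {ε : ℝ} (hε : 0 ≤ ε) {G : ℝ → ℝ}
    {Ω : Set (E n)} (hΩ : ∀ x ∈ Ω, x ≠ 0)
    (hG : ∀ r, 0 < r → G (radialConst γ * (r + ε) ^ alpha γ)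
      = (radialConst γ * (r + ε) ^ alpha γ) ^ (-γ)) :
    IsViscositySol G Ω (omegaShift γ ε) := by
  have hC := radialConst_pos h0 h1
  have hd : ∀ p r : ℝ, 0 < r → HasDerivAt (fun r : ℝ => (r + ε) ^ p) (p * (r + ε) ^ (p - 1)) r := by
    intro p r hr
    have hrε : 0 < r + ε := by linarith
    simpa using ((hasDerivAt_id r).add_const ε).rpow_const (p := p) (Or.inl hrε.ne')
  refine isViscositySol_radial (g := fun r => radialConst γ * (r + ε) ^ alpha γ) hΩ
    (fun r hr => (hd (alpha γ) r hr).const_mul (radialConst γ))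
    (fun r hr => ((hd (alpha γ - 1) r hr).const_mul (alpha γ)).const_mul (radialConst γ))
    (fun r hr => ?_)
  have hrε : 0 < r + ε := by linarith
  rw [hG r hr, Real.mul_rpow hC.le (by positivity), ← Real.rpow_mul hrε.le, radialConst_rpow h0 h1]
  have h2 : (r + ε) ^ (alpha γ * -γ)
      = ((r + ε) ^ (alpha γ - 1)) ^ 2 * (r + ε) ^ (alpha γ - 1 - 1) := by
    rw [← Real.rpow_natCast, ← Real.rpow_mul hrε.le, ← Real.rpow_add hrε]
    congr 1
    push_cast
    linarith [alpha_mul h0]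
  rw [h2]
  ring

theorem omegaShift_zero {n : ℕ} : (omegaShift γ 0 : E n → ℝ) = omega γ := by
  ext x; simp [omegaShift, omega]

theorem omega_pos_iff {n : ℕ} (h0 : 0 ≤ γ) (h1 : γ < 1) {x : E n} : 0 < omega γ x ↔ x ≠ 0 := by
  have hC := radialConst_pos h0 h1
  constructor
  · rintro h rfl
    rw [omega, norm_zero, Real.zero_rpow (alpha_pos h0).ne', mul_zero] at h
    exact lt_irrefl _ h
  · intro h
    have := norm_pos_iff.mpr h
    rw [omega]; positivity

theorem lt_omegaShift_iff {n : ℕ} (h0 : 0 ≤ γ) (h1 : γ < 1) {ε : ℝ} (hε : 0 < ε) {x : E n} :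
    radialConst γ * ε ^ alpha γ < omegaShift γ ε x ↔ x ≠ 0 := by
  have hC := radialConst_pos h0 h1
  have hα0 := alpha_pos h0
  constructor
  · rintro h rfl
    simp [omegaShift] at h
  · intro h
    have := norm_pos_iff.mpr h
    rw [omegaShift]
    gcongr
    linarith

/-- The origin is a limit of other points because the dimension is positive. -/
theorem frontier_punctured_ball {n : ℕ} (hn : 0 < n) {R : ℝ} (hR : 0 < R) :
    frontier {x : E n | x ∈ Metric.ball 0 R ∧ x ≠ 0} ∩ Metric.ball 0 R = {0} := by
  have : Nonempty (Fin n) := ⟨⟨0, hn⟩⟩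
  have hset : {x : E n | x ∈ Metric.ball 0 R ∧ x ≠ 0} = Metric.ball 0 R ∩ {0}ᶜ := rfl
  have hopen : IsOpen (Metric.ball (0 : E n) R ∩ {0}ᶜ) :=
    Metric.isOpen_ball.inter isOpen_compl_singleton
  have h0R : (0 : E n) ∈ Metric.ball 0 R := Metric.mem_ball_self hR
  rw [hset, hopen.frontier_eq]
  ext x
  constructor
  · rintro ⟨⟨-, hx⟩, hxR⟩
    by_contra h
    exact hx ⟨hxR, h⟩
  · rintro rfl
    refine ⟨⟨?_, fun h => h.2 rfl⟩, h0R⟩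
    exact (dense_compl_singleton (0 : E n)).open_subset_closure_inter Metric.isOpen_ball h0R

theorem isLUB_omega {n : ℕ} (hn : 0 < n) (h0 : 0 ≤ γ) (h1 : γ < 1) {r : ℝ} (hr : 0 < r) :
    IsLUB (omega γ '' Metric.ball (0 : E n) r) (radialConst γ * r ^ alpha γ) := by
  have hC := radialConst_pos h0 h1
  have hα0 := alpha_pos h0
  refine ⟨?_, fun b hb => ?_⟩
  · rintro _ ⟨x, hx, rfl⟩
    have := mem_ball_zero_iff.mp hx
    rw [omega]
    gcongr
  · obtain ⟨e, he⟩ := exists_norm_eq_one hn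
    have hlim : Tendsto (powerProfile γ) (𝓝[<] r) (𝓝 (powerProfile γ r)) :=
      ((continuous_powerProfile h0).tendsto r).mono_left nhdsWithin_le_nhds
    rw [← powerProfile_of_nonneg hr.le]
    refine le_of_tendsto hlim ?_
    filter_upwards [Ioo_mem_nhdsLT hr] with t ht
    have hte : ‖t • e‖ = t := by rw [norm_smul, he, mul_one, Real.norm_of_nonneg ht.1.le]
    refine hb ⟨t • e, mem_ball_zero_iff.mpr (by rw [hte]; exact ht.2), ?_⟩
    rw [omega, hte, powerProfile_of_nonneg ht.1.le]

theorem omega_isC1HolderAt {n : ℕ} (h0 : 0 ≤ γ) (h1 : γ < 1) :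
    IsC1HolderAt (alpha γ - 1) (omega γ) (0 : E n) := by
  have hC := radialConst_pos h0 h1
  refine ⟨0, radialConst γ, 1, one_pos, fun y _ => ?_⟩
  rw [omega, omega, norm_zero, Real.zero_rpow (alpha_pos h0).ne']
  simp only [mul_zero, sub_zero, zero_apply, add_sub_cancel]
  rw [abs_of_nonneg (by positivity)]

theorem omega_not_isC1HolderAt {n : ℕ} (hn : 0 < n) (h0 : 0 ≤ γ) (h1 : γ < 1) {β : ℝ}
    (hβ : alpha γ - 1 < β) : ¬ IsC1HolderAt β (omega γ) (0 : E n) := by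
  rintro ⟨p, K, r, hr, h⟩
  have hC := radialConst_pos h0 h1
  obtain ⟨e, he⟩ := exists_norm_eq_one hn
  have key : ∀ t ∈ Ioo 0 r, radialConst γ ≤ K * t ^ (1 + β - alpha γ) := by
    intro t ht
    have hte : ‖t • e‖ = t := by rw [norm_smul, he, mul_one, Real.norm_of_nonneg ht.1.le]
    have ha := h (t • e) (mem_ball_zero_iff.mpr (by rw [hte]; exact ht.2))
    have hb := h (-(t • e)) (mem_ball_zero_iff.mpr (by rw [norm_neg, hte]; exact ht.2))
    simp only [omega, norm_zero, Real.zero_rpow (alpha_pos h0).ne', mul_zero, sub_zero, norm_neg,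
      hte, map_neg] at ha hb
    -- Adding the estimates at `t • e` and its negative cancels the linear map `p`.
    have h2 : radialConst γ * t ^ alpha γ ≤ K * t ^ (1 + β) := by
      linarith [(abs_le.mp ha).2, (abs_le.mp hb).2]
    have htα : 0 < t ^ alpha γ := Real.rpow_pos_of_pos ht.1 _
    rw [Real.rpow_sub ht.1, ← mul_div_assoc, le_div_iff₀ htα]
    exact h2
  have hpos : 0 < 1 + β - alpha γ := by linarith
  have hlim : Tendsto (fun t : ℝ => K * t ^ (1 + β - alpha γ)) (𝓝[>] 0) (𝓝 (K * 0)) := by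
    refine Tendsto.const_mul K ?_
    have := (Real.continuous_rpow_const hpos.le).tendsto 0
    rw [Real.zero_rpow hpos.ne'] at this
    exact this.mono_left nhdsWithin_le_nhds
  have : radialConst γ ≤ K * 0 := ge_of_tendsto hlim (by
    filter_upwards [Ioo_mem_nhdsGT hr] with t ht using key t ht)
  linarith

theorem isLeast_omegaShift {n : ℕ} (h0 : 0 ≤ γ) (h1 : γ < 1) {ε R : ℝ} (hε : 0 < ε) (hR : 0 < R) :
    IsLeast (omegaShift γ ε '' Metric.ball (0 : E n) R) (radialConst γ * ε ^ alpha γ) := by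
  have hC := radialConst_pos h0 h1
  have hα0 := alpha_pos h0
  refine ⟨⟨0, Metric.mem_ball_self hR, by simp [omegaShift]⟩, ?_⟩
  rintro _ ⟨x, -, rfl⟩
  have := norm_nonneg x
  rw [omegaShift]
  gcongr
  linarith

theorem omega_isFreeBoundarySol {n : ℕ} (h0 : 0 ≤ γ) (h1 : γ < 1) {C R : ℝ} (hR : 0 < R)
    (hC : radialConst γ * R ^ alpha γ = C) :
    IsFreeBoundarySol γ (Metric.ball (0 : E n) R) (fun _ => C) (omega γ) := by
  have hC0 := radialConst_pos h0 h1
  refine ⟨(continuous_omega h0).continuousOn, fun x _ => ?_, ?_, fun x hx => ?_⟩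
  · rw [omega]; positivity
  · rw [← omegaShift_zero]
    refine isViscositySol_shift h0 h1 le_rfl (fun x hx => ?_) fun _ _ => rfl
    rw [omegaShift_zero] at hx
    exact (omega_pos_iff h0 h1).mp hx.2
  · rw [frontier_ball _ hR.ne', mem_sphere_zero_iff_norm] at hx
    simp only [omega, hx, hC]

theorem isBoundaryDatum_const {n : ℕ} (Ω : Set (E n)) {c : ℝ} (hc : 0 ≤ c) :
    IsBoundaryDatum Ω (fun _ => c) := by
  refine ⟨fun _ _ => hc, fun _ => c, contDiff_const, ⟨0, ?_⟩, fun _ _ => rfl⟩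
  rw [fderiv_fun_const]
  exact LipschitzWith.const _

end Explicit

/-! ### Assembly -/

/-- The radial minimal solutions with suitable constant data converge to `ω`. -/
theorem exists_radial_approximation {n : ℕ} (hn : 0 < n) {γ δ C R : ℝ} {B : ℝ → ℝ} (h0 : 0 ≤ γ)
    (h1 : γ < 1) (hB : IsCutoff δ B) (hR : 0 < R) (hC : radialConst γ * R ^ alpha γ = C) :
    ∃ (c : ℝ → ℝ) (u : ℝ → E n → ℝ), Tendsto c (𝓝[>] 0) (𝓝 C) ∧
      IsLimitOfMinimal γ B (Metric.ball (0 : E n) R) (fun _ => C) (fun ε _ => c ε) u (omega γ) ∧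
      (∀ ε, 0 < ε → ∀ x ∈ Metric.closedBall (0 : E n) R, ∀ y ∈ Metric.closedBall (0 : E n) R,
        ‖x‖ = ‖y‖ → u ε x = u ε y) ∧
      TendstoUniformlyOn u (omega γ) (𝓝[>] 0) (Metric.closedBall (0 : E n) R) := by
  have hC0 := radialConst_pos h0 h1
  have hα0 := alpha_pos h0
  have hα1 := one_lt_alpha h0 h1
  choose! c g hc0 hmin hcl hcu hg using fun (ε : ℝ) (hε : 0 < ε) =>
    exists_minimal_radial (n := n) hn h0 h1 hB hε hR
  set h : ℝ → ℝ := fun ε => radius γ (δ * ε ^ alpha γ) with hh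
  have hh0 : Tendsto h (𝓝[>] 0) (𝓝 0) := by
    have hcont : Continuous h := (continuous_radius h0).comp
      (continuous_const.mul (Real.continuous_rpow_const hα0.le))
    have h2 : h 0 = 0 := by
      simp only [hh, radius]
      rw [Real.zero_rpow hα0.ne', mul_zero, zero_div, Real.zero_rpow (one_div_pos.mpr hα0).ne']
    have := hcont.tendsto 0
    rw [h2] at this
    exact this.mono_left nhdsWithin_le_nhds
  have hpos : ∀ᶠ ε : ℝ in 𝓝[>] 0, 0 < ε := self_mem_nhdsWithin
  have hhpos : ∀ ε, 0 < ε → 0 ≤ h ε := fun ε hε =>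
    radius_nonneg h0 h1 (by have := threshold_pos (γ := γ) hB hε; linarith)
  have hctend : Tendsto c (𝓝[>] 0) (𝓝 C) := by
    have hup : Tendsto (fun ε => radialConst γ * (R + h ε) ^ alpha γ) (𝓝[>] 0) (𝓝 C) := by
      have hcont : Continuous fun t : ℝ => radialConst γ * (R + t) ^ alpha γ :=
        continuous_const.mul ((Real.continuous_rpow_const hα0.le).comp
          (continuous_const.add continuous_id))
      have := (hcont.tendsto 0).comp hh0
      simpa [Function.comp_def, hC] using this
    -- The correction term tends to zero because `α > 1`.
    have hlow : Tendsto (fun ε => radialConst γ * ((R + h ε) ^ alpha γ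
        - alpha γ * h ε ^ (alpha γ - 1) * R)) (𝓝[>] 0) (𝓝 C) := by
      have hcont : Continuous fun t : ℝ =>
          radialConst γ * ((R + t) ^ alpha γ - alpha γ * t ^ (alpha γ - 1) * R) :=
        continuous_const.mul (((Real.continuous_rpow_const hα0.le).comp
          (continuous_const.add continuous_id)).sub ((continuous_const.mul
            (Real.continuous_rpow_const (by linarith))).mul continuous_const))
      have := (hcont.tendsto 0).comp hh0
      rw [add_zero, Real.zero_rpow (by linarith), mul_zero, zero_mul, sub_zero, hC] at this
      exact this
    exact tendsto_of_tendsto_of_tendsto_of_le_of_le' hlow hup (hpos.mono hcl) (hpos.mono hcu)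
  have hunif : TendstoUniformlyOn (fun ε (x : E n) => g ε ‖x‖) (omega γ) (𝓝[>] 0)
      (Metric.closedBall 0 R) := by
    have he : Tendsto (fun ε => radius γ (c ε) - R) (𝓝[>] 0) (𝓝 0) := by
      have h2 := (((continuous_radius h0).tendsto C).comp hctend).sub_const R
      rwa [← hC, radius_radialConst_mul h0 h1 hR.le, sub_self] at h2
    -- The sign of the shift `radius γ (c ε) - R` is not controlled, hence the positive part in
    -- `powerProfile`.
    have hF := tendstoUniformlyOn_radial_shift (n := n) (continuous_powerProfile h0) he R
    have hH := tendstoUniformlyOn_radial_shift (n := n) (continuous_powerProfile h0) hh0 R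
    rw [powerProfile_norm] at hF hH
    have hnorm : ∀ x ∈ Metric.closedBall (0 : E n) R, ‖x‖ ∈ Icc 0 R := fun x hx =>
      ⟨norm_nonneg x, mem_closedBall_zero_iff.mp hx⟩
    refine tendstoUniformlyOn_squeeze hF hH ?_ ?_
    · exact hpos.mono fun ε hε x hx => (hg ε hε _ (hnorm x hx)).1
    · refine hpos.mono fun ε hε x hx => ?_
      rw [powerProfile_of_nonneg (add_nonneg (norm_nonneg x) (hhpos ε hε))]
      exact (hg ε hε _ (hnorm x hx)).2
  have hfree := omega_isFreeBoundarySol (n := n) h0 h1 hR hC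
  refine ⟨c, fun ε x => g ε ‖x‖, hctend, ⟨?_, ?_, hmin, ?_, hfree.continuousOn, hfree.boundary⟩,
    fun ε _ x _ y _ hxy => by simp only [hxy], hunif⟩
  · exact fun ε hε => isBoundaryDatum_const _ (hc0 ε hε).le
  · rw [Metric.tendstoUniformlyOn_iff]
    intro η hη
    filter_upwards [hctend.eventually (Metric.ball_mem_nhds C hη)] with ε hε x _
    rw [dist_comm]; exact hε
  · exact (hunif.mono Metric.ball_subset_closedBall).tendstoLocallyUniformlyOn

end SingInf

theorem proposition6p1 (n : ℕ) (hn : 0 < n) (γ : ℝ) (hγ0 : 0 ≤ γ) (hγ1 : γ < 1)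
    (δ : ℝ) (B : ℝ → ℝ) (hB : SingInf.IsCutoff δ B)
    (C R : ℝ) (hC : 0 < C) (hR : 0 < R)
    (hRC : R = (C / SingInf.radialConst γ) ^ (1 / SingInf.alpha γ)) :
    -- `ω` is a limiting solution in `B_R` with boundary datum `C`
    SingInf.IsLimitingSol γ B (Metric.ball (0 : SingInf.E n) R) (fun _ => C) (SingInf.omega γ) ∧
    -- the approximating minimal solutions can be taken radial, with constant boundary data
    (∃ Cε : ℝ → ℝ, ∃ uε : ℝ → SingInf.E n → ℝ, Tendsto Cε (𝓝[>] 0) (𝓝 C) ∧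
      SingInf.IsLimitOfMinimal γ B (Metric.ball (0 : SingInf.E n) R) (fun _ => C)
        (fun ε _ => Cε ε) uε (SingInf.omega γ) ∧
      (∀ ε, 0 < ε → ∀ x ∈ Metric.closedBall (0 : SingInf.E n) R,
        ∀ y ∈ Metric.closedBall (0 : SingInf.E n) R, ‖x‖ = ‖y‖ → uε ε x = uε ε y) ∧
      TendstoUniformlyOn uε (SingInf.omega γ) (𝓝[>] 0)
        (Metric.closedBall (0 : SingInf.E n) R)) ∧
    -- `ω` solves the free boundary problem
    SingInf.IsFreeBoundarySol γ (Metric.ball (0 : SingInf.E n) R) (fun _ => C)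
      (SingInf.omega γ) ∧
    -- the explicit profiles `ω_ε`
    (∀ ε, 0 < ε → δ ≤ SingInf.radialConst γ →
      SingInf.IsViscositySol (SingInf.penalizedRHS γ B ε)
        (Metric.ball (0 : SingInf.E n) R \ {0}) (SingInf.omegaShift γ ε)) ∧
    (∀ ε, 0 < ε → ∀ x ∈ frontier (Metric.ball (0 : SingInf.E n) R),
      SingInf.omegaShift γ ε x = SingInf.radialConst γ * (R + ε) ^ SingInf.alpha γ) ∧
    Tendsto (fun ε : ℝ => SingInf.radialConst γ * (R + ε) ^ SingInf.alpha γ)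
      (𝓝[>] 0) (𝓝 C) ∧
    TendstoUniformlyOn (fun ε => SingInf.omegaShift (n := n) γ ε) (SingInf.omega γ) (𝓝[>] 0)
      (Metric.closedBall (0 : SingInf.E n) R) ∧
    (∀ ε, 0 < ε →
      IsLeast (SingInf.omegaShift γ ε '' Metric.ball (0 : SingInf.E n) R)
        (SingInf.radialConst γ * ε ^ SingInf.alpha γ) ∧
      frontier {x | x ∈ Metric.ball (0 : SingInf.E n) R ∧
          SingInf.radialConst γ * ε ^ SingInf.alpha γ < SingInf.omegaShift γ ε x} ∩
        Metric.ball (0 : SingInf.E n) R = {0}) ∧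
    -- the free boundary is the origin
    SingInf.freeBoundary (Metric.ball (0 : SingInf.E n) R) (SingInf.omega γ) = {0} ∧
    -- the exponent `α` is attained at the free boundary and cannot be improved
    (∀ r, 0 < r → r ≤ R →
      IsLUB (SingInf.omega γ '' Metric.ball (0 : SingInf.E n) r)
        (SingInf.radialConst γ * r ^ SingInf.alpha γ)) ∧
    SingInf.IsC1HolderAt (SingInf.alpha γ - 1) (SingInf.omega γ) (0 : SingInf.E n) ∧
    (∀ β, SingInf.alpha γ - 1 < β →
      ¬ SingInf.IsC1HolderAt β (SingInf.omega γ) (0 : SingInf.E n)) := by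
  have hC0 := SingInf.radialConst_pos hγ0 hγ1
  have hα0 := SingInf.alpha_pos hγ0
  have hCR : SingInf.radialConst γ * R ^ SingInf.alpha γ = C := by
    rw [hRC]; exact SingInf.radialConst_mul_radius hγ0 hγ1 hC.le
  obtain ⟨c, u, hc, hlim, hrad, hunif⟩ :=
    SingInf.exists_radial_approximation hn hγ0 hγ1 hB hR hCR
  refine ⟨⟨_, _, hlim⟩, ⟨c, u, hc, hlim, hrad, hunif⟩,
    SingInf.omega_isFreeBoundarySol hγ0 hγ1 hR hCR, ?_, ?_, ?_,
    SingInf.tendstoUniformlyOn_omegaShift hγ0 R, ?_, ?_,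
    fun r hr _ => SingInf.isLUB_omega hn hγ0 hγ1 hr, SingInf.omega_isC1HolderAt hγ0 hγ1,
    fun β hβ => SingInf.omega_not_isC1HolderAt hn hγ0 hγ1 hβ⟩
  · intro ε hε hδ
    refine SingInf.isViscositySol_shift hγ0 hγ1 hε.le (fun x hx => hx.2) fun r hr => ?_
    -- All values of `ω_ε` are at least `C_α ε^α ≥ δ ε^α`, where the cut-off equals one.
    refine SingInf.penalizedRHS_eq_rpow hB hε ?_
    gcongr
    linarith
  · intro ε hε x hx
    rw [frontier_ball _ hR.ne', mem_sphere_zero_iff_norm] at hx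
    rw [SingInf.omegaShift, hx]
  · have hcont : Continuous fun t : ℝ => SingInf.radialConst γ * (R + t) ^ SingInf.alpha γ :=
      continuous_const.mul ((Real.continuous_rpow_const hα0.le).comp
        (continuous_const.add continuous_id))
    have := (hcont.tendsto 0).mono_left (nhdsWithin_le_nhds (s := Ioi 0))
    rwa [add_zero, hCR] at this
  · intro ε hε
    refine ⟨SingInf.isLeast_omegaShift hγ0 hγ1 hε hR, ?_⟩
    simp only [SingInf.lt_omegaShift_iff hγ0 hγ1 hε]
    exact SingInf.frontier_punctured_ball hn hR
  · simp only [SingInf.freeBoundary, SingInf.omega_pos_iff hγ0 hγ1]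
    exact SingInf.frontier_punctured_ball hn hR
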